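/- Let $F$ be a number field with ring of integers $\mathcal{O}_F$, adele ring $\mathbb{A}=F_\infty\times\mathbb{A}_{\mathrm{fin}}$ and class number $h$; let $G=GL_2$ with centre $Z$, and write $a(y)=\begin{pmatrix}y&0\\0&1\end{pmatrix}$, $n(x)=\begin{pmatrix}1&x\\0&1\end{pmatrix}$, $\omega=\begin{pmatrix}0&1\\-1&0\end{pmatrix}$. Put $|y|_\infty=\prod_\nu|y_\nu|^{[F_\nu:\mathbb{R}]}$ for $y\in F_\infty$. For each prime $\mathfrak{p}$ let $\mathfrak{o}_\mathfrak{p}\subset F_\mathfrak{p}$ be the local ring of integers and fix a uniformizer $\varpi_\mathfrak{p}$. Fix finite ideles $\theta_1,\dots,\theta_h\in\widehat{\mathcal{O}}_F\cap\mathbb{A}_{\mathrm{fin}}^\times$ whose ideals $\prod_\mathfrak{p}\mathfrak{p}^{v_\mathfrak{p}(\theta_i)}$ represent each ideal class exactly once. Let $K_\nu=O_2(\mathbb{R})$ or $U_2(\mathbb{C})$ for real resp. complex $\nu$, and $K_\mathfrak{p}=GL_2(\mathfrak{o}_\mathfrak{p})$. Let $K_{0,\mathfrak{p}}(m)$ be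 the set of elements of $K_\mathfrak{p}$ with lower left entry in $\varpi_\mathfrak{p}^m\mathfrak{o}_\mathfrak{p}$, and $K_{1,\mathfrak{p}}(m)$ the set of those elements of $K_{0,\mathfrak{p}}(m)$ whose upper left entry lies in $1+\varpi_\mathfrak{p}^m\mathfrak{o}_\mathfrak{p}$. Let $\mathfrak{n}$ be a nonzero ideal of $\mathcal{O}_F$, $n_\mathfrak{p}=v_\mathfrak{p}(\mathfrak{n})$, $n_{1,\mathfrak{p}}=\lceil n_\mathfrak{p}/2\rceil$, $n_{0,\mathfrak{p}}=n_\mathfrak{p}-n_{1,\mathfrak{p}}$, $\mathfrak{n}_2=\prod_\mathfrak{p}\mathfrak{p}^{n_{1,\mathfrak{p}}-n_{0,\mathfrak{p}}}$, and $K_1(\mathfrak{n})=\prod_\nu K_\nu\prod_\mathfrak{p}K_{1,\mathfrak{p}}(n_\mathfrak{p})$. * For $g\in G(F_\mathfrak{p})$ let $l_\mathfrak{p}(g)$ be the unique $l\in\{0,\dots,n_\mathfrak{p}\}$ such that $g\in Z(F_\mathfrak{p})\,n(x)\,a(\varpi_\mathfrak{p}^t)\,\omega\, n(\varpi_\mathfrak{p}^{-l}v)K_{1,\mathfrak{p}}(n_\mathfrak{p})$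 for some $x\in F_\mathfrak{p}$, $t\in\mathbb{Z}$, $v\in\mathfrak{o}_\mathfrak{p}^\times$. Put $n_{1,\mathfrak{p}}(g)=n_{0,\mathfrak{p}}$ if $l_\mathfrak{p}(g)\le n_{0,\mathfrak{p}}$, and $n_{1,\mathfrak{p}}(g)=n_{1,\mathfrak{p}}$ otherwise. Let $\mathcal{J}_\mathfrak{n}\subset G(\mathbb{A}_{\mathrm{fin}})$ be the set of $g$ such that $g_\mathfrak{p}\in K_\mathfrak{p}a(\varpi_\mathfrak{p}^{n_{1,\mathfrak{p}}})$ and $n_{1,\mathfrak{p}}(g_\mathfrak{p})=n_{0,\mathfrak{p}}$ for $\mathfrak{p}\mid\mathfrak{n}$, and $g_\mathfrak{p}=1$ for $\mathfrak{p}\nmid\mathfrak{n}$. * For an ideal $\mathfrak{L}$ let $\eta_\mathfrak{L}\in G(\mathbb{A})$ have component $\begin{pmatrix}0&1\\ \varpi_\mathfrak{p}^{n_\mathfrak{p}}&0\end{pmatrix}$ at $\mathfrak{p}\mid\mathfrak{L}$ and $1$ at all other places. * Let $K^*=\prod_\nu Z(F_\nu)K_\nu\prod_{\mathfrak{p}\nmid\mathfrak{n}_2}Z(F_\mathfrak{p})K_\mathfrak{p}\prod_{\mathfrak{p}\mid\mathfrak{n}_2}\left\langle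 K_{0,\mathfrak{p}}(1),\begin{pmatrix}0&1\\ \varpi_\mathfrak{p}&0\end{pmatrix}\right\rangle$ (inside $G(\mathbb{A})$). A special matrix is an element $\begin{pmatrix}y&x\\0&1\end{pmatrix}a(\theta_i)$ with $y\in F_\infty^\times$, $x\in F_\infty$, $1\le i\le h$. Let $\mathcal{F}(\mathfrak{n}_2)$ be the set of special matrices for which $|y|_\infty$ is maximal among all special matrices in the same double coset in $G(F)\backslash G(\mathbb{A})/K^*$, and let $\mathcal{F}_{\mathfrak{n}_2}\subset G(F_\infty)$ be the set of all $\begin{pmatrix}y&x\\0&1\end{pmatrix}$ such that $\begin{pmatrix}y&x\\0&1\end{pmatrix}a(\theta_i)\in\mathcal{F}(\mathfrak{n}_2)$ for some $i$. Then the following hold. (1) For every $g\in G(\mathbb{A})$ there are an ideal $\mathfrak{L}\mid\mathfrak{n}_2$ and $1\le i\le h$ such that $$g\in Z(\mathbb{A})\,G(F)\,\bigl(a(\theta_i)\mathcal{J}_\mathfrak{n}\times\mathcal{F}_{\mathfrak{n}_2}\bigr)\,\eta_\mathfrak{L}\,K_1(\mathfrak{n}).$$ (2) Let $\varphi\colon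 G(\mathbb{A})\to\mathbb{C}$ be left $G(F)$-invariant and right $K_1(\mathfrak{n})$-invariant, and suppose that $\varphi(zg)=\omega_\varphi(z)\varphi(g)$ for all $z\in Z(\mathbb{A})=\mathbb{A}^\times$, with a unitary character $\omega_\varphi$ of $\mathbb{A}^\times$ (for instance, let $\varphi$ be the newform of a cuspidal automorphic representation of conductor $\mathfrak{n}$ with unitary central character $\omega_\varphi$ that is spherical at the archimedean places). For every $\mathfrak{L}\mid\mathfrak{n}_2$ let $\omega^\mathfrak{L}$ be a unitary character of $\mathbb{A}^\times$ which is trivial on $\prod_{\mathfrak{p}\mid\mathfrak{L}}\mathfrak{o}_\mathfrak{p}^\times$ and agrees with $\omega_\varphi$ on $\prod_{\mathfrak{p}\nmid\mathfrak{L}}\mathfrak{o}_\mathfrak{p}^\times$, and put $\varphi^\mathfrak{L}(g)=\omega_\varphi^{-1}\omega^\mathfrak{L}(\det g)\,\varphi(g\eta_\mathfrak{L})$. Then, in $[0,\infty]$, $$\sup_{g\in G(\mathbb{A})}|\varphi(g)|\le\sup_{\mathfrak{L}\mid\mathfrak{n}_2}\ \sup_{1\le i\le h}\ \sup_{g\in\mathcal{J}_\mathfrak{n}\times\mathcal{F}_{\mathfrak{n}_2}}\bigl|\varphi^\mathfrak{L}(a(\theta_i)g)\bigr|.$$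 -/

import Mathlib

open NumberField IsDedekindDomain Matrix
open scoped MatrixGroups nonZeroDivisors

namespace AdelicGL2

noncomputable section

/-! ### Elementary matrices over a commutative ring -/

section Ring

variable {R : Type*} [CommRing R]

/-- The matrix `a(y) = (y 0; 0 1)`. -/
def aMat (y : Rˣ) : GL (Fin 2) R where
  val := !![(y : R), 0; 0, 1]
  inv := !![((y⁻¹ : Rˣ) : R), 0; 0, 1]
  val_inv := by ext i j; fin_cases i <;> fin_cases j <;> simp [Matrix.mul_apply]
  inv_val := by ext i j; fin_cases i <;> fin_cases j <;> simp [Matrix.mul_apply]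

/-- The matrix `n(x) = (1 x; 0 1)`. -/
def nMat (x : R) : GL (Fin 2) R where
  val := !![1, x; 0, 1]
  inv := !![1, -x; 0, 1]
  val_inv := by ext i j; fin_cases i <;> fin_cases j <;> simp [Matrix.mul_apply]
  inv_val := by ext i j; fin_cases i <;> fin_cases j <;> simp [Matrix.mul_apply]

/-- The matrix `(0 1; u 0)`. -/
def antiMat (u : Rˣ) : GL (Fin 2) R where
  val := !![0, 1; (u : R), 0]
  inv := !![0, ((u⁻¹ : Rˣ) : R); 1, 0]
  val_inv := by ext i j; fin_cases i <;> fin_cases j <;> simp [Matrix.mul_apply]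
  inv_val := by ext i j; fin_cases i <;> fin_cases j <;> simp [Matrix.mul_apply]

/-- The long Weyl element `ω = (0 1; -1 0)`. -/
def weyl : GL (Fin 2) R := antiMat (-1)

/-- The scalar matrix `z(r)`. -/
def zMat (r : Rˣ) : GL (Fin 2) R := Matrix.GeneralLinearGroup.scalar (Fin 2) r

/-- The matrix `(y x; 0 1) = n(x) a(y)`. -/
def bMat (y : Rˣ) (x : R) : GL (Fin 2) R := nMat x * aMat y

end Ring

variable {F : Type*} [Field F] [NumberField F]

/-! ### Exponents of ideals -/

/-- `n_𝔭 = v_𝔭(𝔫)`, the exponent of the prime `𝔭` in the nonzero ideal `𝔫`. -/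
def ordAt (𝔫 : Ideal (𝓞 F)) (p : HeightOneSpectrum (𝓞 F)) : ℕ :=
  open Classical in (Associates.mk p.asIdeal).count (Associates.mk 𝔫).factors

/-- `n_{1,𝔭} = ⌈n_𝔭 / 2⌉`. -/
def ord1 (𝔫 : Ideal (𝓞 F)) (p : HeightOneSpectrum (𝓞 F)) : ℕ := (ordAt 𝔫 p + 1) / 2

/-- `n_{0,𝔭} = n_𝔭 - n_{1,𝔭}` (there is no truncation, as `n_{1,𝔭} ≤ n_𝔭`). -/
def ord0 (𝔫 : Ideal (𝓞 F)) (p : HeightOneSpectrum (𝓞 F)) : ℕ := ordAt 𝔫 p - ord1 𝔫 p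

/-- The square-free ideal `𝔫₂ = ∏ 𝔭 ^ (n_{1,𝔭} - n_{0,𝔭})`. -/
def sqfreePart (𝔫 : Ideal (𝓞 F)) : Ideal (𝓞 F) :=
  ∏ᶠ p : HeightOneSpectrum (𝓞 F), p.asIdeal ^ (ord1 𝔫 p - ord0 𝔫 p)

theorem ordAt_eventually_eq_zero (𝔫 : Ideal (𝓞 F)) :
    ∀ᶠ p : HeightOneSpectrum (𝓞 F) in Filter.cofinite, ordAt 𝔫 p = 0 := by
  classical
  by_cases h : 𝔫 = 0
  · subst h
    exact Filter.Eventually.of_forall fun p => by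
      unfold ordAt
      rw [Associates.mk_zero, Associates.factors_zero]
      rw [Associates.count, dif_pos p.associates_irreducible]
      rfl
  · filter_upwards [Associates.finite_factors h] with p hp
    unfold ordAt
    exact_mod_cast hp

/-! ### Adeles and their components -/

/-- The adele ring `𝔸_F = F_∞ × 𝔸_fin`. -/
abbrev Adele (F : Type*) [Field F] [NumberField F] := AdeleRing (𝓞 F) F

/-- The ring of finite adeles. -/
abbrev FinAdele (F : Type*) [Field F] [NumberField F] := FiniteAdeleRing (𝓞 F) F

/-- The projection of `𝔸_fin` to `F_𝔭`. -/
def evalFin (p : HeightOneSpectrum (𝓞 F)) : FinAdele F →+* p.adicCompletion F where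
  toFun a := a p
  map_one' := rfl
  map_mul' _ _ := rfl
  map_zero' := rfl
  map_add' _ _ := rfl

/-- The projection of `𝔸_F` to `𝔸_fin`. -/
def projFin : Adele F →+* FinAdele F where
  toFun a := a.2
  map_one' := rfl
  map_mul' _ _ := rfl
  map_zero' := rfl
  map_add' _ _ := rfl

/-- The projection of `𝔸_F` to `F_ν`, `ν` archimedean. -/
def evalInf (v : InfinitePlace F) : Adele F →+* v.Completion where
  toFun a := a.1 v
  map_one' := rfl
  map_mul' _ _ := rfl
  map_zero' := rfl
  map_add' _ _ := rfl

/-- The `𝔭`-component of an element of `GL₂(𝔸_fin)`. -/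
def compFin (p : HeightOneSpectrum (𝓞 F)) : GL (Fin 2) (FinAdele F) →* GL (Fin 2) (p.adicCompletion F) :=
  Matrix.GeneralLinearGroup.map (evalFin p)

/-- The finite part of an element of `GL₂(𝔸_F)`. -/
def finPart : GL (Fin 2) (Adele F) →* GL (Fin 2) (FinAdele F) :=
  Matrix.GeneralLinearGroup.map projFin

/-- The `ν`-component of an element of `GL₂(𝔸_F)`, `ν` archimedean. -/
def compInf (v : InfinitePlace F) : GL (Fin 2) (Adele F) →* GL (Fin 2) v.Completion :=
  Matrix.GeneralLinearGroup.map (evalInf v)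

/-- The diagonal embedding `GL₂(F) → GL₂(𝔸_F)`. -/
def rational : GL (Fin 2) F →* GL (Fin 2) (Adele F) :=
  Matrix.GeneralLinearGroup.map (algebraMap F (Adele F))

/-- The element of `GL₂(𝔸_F) = GL₂(F_∞) × GL₂(𝔸_fin)` with the given two components. -/
def glPair (b : GL (Fin 2) (InfiniteAdeleRing F)) (g : GL (Fin 2) (FinAdele F)) :
    GL (Fin 2) (Adele F) where
  val := Matrix.of fun i j => (b.val i j, g.val i j)
  inv := Matrix.of fun i j => (b⁻¹.val i j, g⁻¹.val i j)
  val_inv := by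
    ext i j
    have hb := congrFun (congrFun b.val_inv i) j
    have hg := congrFun (congrFun g.val_inv i) j
    rw [Matrix.mul_apply, Fin.sum_univ_two] at hb hg ⊢
    refine Prod.ext (hb.trans ?_) (hg.trans ?_) <;> fin_cases i <;> fin_cases j <;> rfl
  inv_val := by
    ext i j
    have hb := congrFun (congrFun b.inv_val i) j
    have hg := congrFun (congrFun g.inv_val i) j
    rw [Matrix.mul_apply, Fin.sum_univ_two] at hb hg ⊢
    refine Prod.ext (hb.trans ?_) (hg.trans ?_) <;> fin_cases i <;> fin_cases j <;> rfl

/-! ### Local compact groups -/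

/-- `K_ν`: `O₂(ℝ)` at a real place and `U₂(ℂ)` at a complex place. At a real place the embedding
`F_ν → ℂ` has real values, so that the unitary matrices in its image are the orthogonal ones. -/
def KInf (v : InfinitePlace F) : Set (GL (Fin 2) v.Completion) :=
  {g | g.val.map (InfinitePlace.Completion.extensionEmbedding v) ∈ Matrix.unitaryGroup (Fin 2) ℂ}

/-- `K_𝔭 = GL₂(𝔬_𝔭)`. -/
def KFin (p : HeightOneSpectrum (𝓞 F)) : Subgroup (GL (Fin 2) (p.adicCompletion F)) :=
  (Matrix.GeneralLinearGroup.map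
    (algebraMap (p.adicCompletionIntegers F) (p.adicCompletion F))).range

/-- `K_{0,𝔭}(n)`: the lower left entry lies in `ϖ_𝔭 ^ n 𝔬_𝔭`. -/
def K0Fin (p : HeightOneSpectrum (𝓞 F)) (n : ℕ) : Set (GL (Fin 2) (p.adicCompletion F)) :=
  {g | g ∈ KFin p ∧ Valued.v (g.val 1 0) ≤ WithZero.exp (-(n : ℤ))}

/-- `K_{1,𝔭}(n)`: moreover the upper left entry lies in `1 + ϖ_𝔭 ^ n 𝔬_𝔭`. -/
def K1Fin (p : HeightOneSpectrum (𝓞 F)) (n : ℕ) : Set (GL (Fin 2) (p.adicCompletion F)) :=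
  {g | g ∈ KFin p ∧ Valued.v (g.val 0 0 - 1) ≤ WithZero.exp (-(n : ℤ)) ∧
    Valued.v (g.val 1 0) ≤ WithZero.exp (-(n : ℤ))}

/-- `K₁(𝔫) = K_∞ ∏ K_{1,𝔭}(v_𝔭(𝔫))`. -/
def K1 (𝔫 : Ideal (𝓞 F)) : Set (GL (Fin 2) (Adele F)) :=
  {g | (∀ v, compInf v g ∈ KInf v) ∧ ∀ p, compFin p (finPart g) ∈ K1Fin p (ordAt 𝔫 p)}

/-! ### Uniformizers and class group representatives -/

/-- A choice of a uniformizer `ϖ_𝔭` of `F_𝔭` for every `𝔭`. -/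
def Uniformizers (F : Type*) [Field F] [NumberField F] :=
  ∀ p : HeightOneSpectrum (𝓞 F), {x : p.adicCompletion F // Valued.v x = WithZero.exp (-1 : ℤ)}

/-- The uniformizer `ϖ_𝔭` as an element of `F_𝔭ˣ`. -/
def Uniformizers.unit (ϖ : Uniformizers F) (p : HeightOneSpectrum (𝓞 F)) : (p.adicCompletion F)ˣ :=
  Units.mk0 (ϖ p).1 (by
    intro h
    have := (ϖ p).2
    rw [h, map_zero] at this
    exact WithZero.exp_ne_zero this.symm)

/-- `θ_1, …, θ_h` are finite ideles that lie in `𝒪̂_F` and whose ideals `∏ 𝔭 ^ v_𝔭(θ_i)` represent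
every ideal class exactly once. -/
structure IsClassRepresentatives (θ : Fin (NumberField.classNumber F) → (FinAdele F)ˣ) : Prop where
  integral : ∀ i p, Valued.v ((θ i : FinAdele F) p) ≤ 1
  existsUnique : ∀ C : ClassGroup (𝓞 F), ∃! i, ∃ I : (Ideal (𝓞 F))⁰,
    (∀ p, Valued.v ((θ i : FinAdele F) p) = WithZero.exp (-(ordAt I.1 p : ℤ))) ∧
      ClassGroup.mk0 I = C

/-! ### The set `𝒥` -/

/-- The set `⋃_{t, v} Z(F_𝔭) N(F_𝔭) a(ϖ ^ t) ω n(ϖ ^ (-l) v) K_{1,𝔭}(n)`, with `t` in `ℤ` and `v` in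
`𝔬_𝔭ˣ`. For `0 ≤ l ≤ n` these sets partition `GL₂(F_𝔭)`. -/
def localCell (ϖ : Uniformizers F) (p : HeightOneSpectrum (𝓞 F)) (n l : ℕ) :
    Set (GL (Fin 2) (p.adicCompletion F)) :=
  {g | ∃ (z : (p.adicCompletion F)ˣ) (x : p.adicCompletion F) (t : ℤ) (v : p.adicCompletion F),
    Valued.v v = 1 ∧ ∃ k ∈ K1Fin p n,
      g = zMat z * nMat x * (aMat (ϖ.unit p ^ t) * weyl *
        nMat (((ϖ.unit p ^ (-(l : ℤ)) : (p.adicCompletion F)ˣ) : p.adicCompletion F) * v)) * k}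

/-- The invariant `l_𝔭(g)`: the unique `l` with `0 ≤ l ≤ n` such that `g` lies in the `l`-th cell. -/
def lInv (ϖ : Uniformizers F) (p : HeightOneSpectrum (𝓞 F)) (n : ℕ)
    (g : GL (Fin 2) (p.adicCompletion F)) : ℕ :=
  sInf {l | l ≤ n ∧ g ∈ localCell ϖ p n l}

/-- The invariant `n_{1,𝔭}(g)`, equal to `n_{0,𝔭}` if `l_𝔭(g) ≤ n_{0,𝔭}` and to `n_{1,𝔭}` if
`l_𝔭(g) ≥ n_{1,𝔭}`; since `n_{1,𝔭} ≤ n_{0,𝔭} + 1`, this covers all cases. -/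
def n1Inv (ϖ : Uniformizers F) (𝔫 : Ideal (𝓞 F)) (p : HeightOneSpectrum (𝓞 F))
    (g : GL (Fin 2) (p.adicCompletion F)) : ℕ :=
  if lInv ϖ p (ordAt 𝔫 p) g ≤ ord0 𝔫 p then ord0 𝔫 p else ord1 𝔫 p

/-- `J_𝔏 = K_𝔏 h_𝔏` inside `GL₂(𝔸_fin)`: the component at `𝔭 ∣ 𝔏` lies in
`K_𝔭 a(ϖ_𝔭 ^ n_{1,𝔭})`, the component at `𝔭 ∤ 𝔏` is `1`. -/
def bigJ (ϖ : Uniformizers F) (𝔫 𝔏 : Ideal (𝓞 F)) : Set (GL (Fin 2) (FinAdele F)) :=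
  {g | (∀ p : HeightOneSpectrum (𝓞 F), p.asIdeal ∣ 𝔏 →
      ∃ k ∈ KFin p, compFin p g = k * aMat (ϖ.unit p ^ ord1 𝔫 p)) ∧
    ∀ p : HeightOneSpectrum (𝓞 F), ¬ p.asIdeal ∣ 𝔏 → compFin p g = 1}

/-- `𝒥_𝔏 = {g ∈ J_𝔏 : n_{1,𝔭}(g_𝔭) = n_{0,𝔭} for all 𝔭 ∣ 𝔏}`. -/
def calJ (ϖ : Uniformizers F) (𝔫 𝔏 : Ideal (𝓞 F)) : Set (GL (Fin 2) (FinAdele F)) :=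
  {g | g ∈ bigJ ϖ 𝔫 𝔏 ∧ ∀ p : HeightOneSpectrum (𝓞 F), p.asIdeal ∣ 𝔏 →
    n1Inv ϖ 𝔫 p (compFin p g) = ord0 𝔫 p}

/-! ### The matrices `η_𝔏` -/

theorem valued_le_one_of_mem_KFin {p : HeightOneSpectrum (𝓞 F)}
    {g : GL (Fin 2) (p.adicCompletion F)} (hg : g ∈ KFin p) (i j : Fin 2) :
    g.val i j ∈ p.adicCompletionIntegers F := by
  obtain ⟨k, rfl⟩ := hg
  exact (k.val i j).2

/-- The element of `GL₂(𝔸_fin)` with given components, almost all of which lie in `K_𝔭`. -/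
def finOfLocal (g : ∀ p : HeightOneSpectrum (𝓞 F), GL (Fin 2) (p.adicCompletion F))
    (h : ∀ᶠ p in Filter.cofinite, g p ∈ KFin p) : GL (Fin 2) (FinAdele F) where
  val := Matrix.of fun i j =>
    ⟨fun p => (g p).val i j, h.mono fun _ hp => valued_le_one_of_mem_KFin hp i j⟩
  inv := Matrix.of fun i j =>
    ⟨fun p => (g p)⁻¹.val i j, h.mono fun _ hp => valued_le_one_of_mem_KFin (inv_mem hp) i j⟩
  val_inv := by
    ext i j : 1
    refine FiniteAdeleRing.ext _ fun p => ?_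
    have hg := congrFun (congrFun (g p).val_inv i) j
    rw [Matrix.mul_apply, Fin.sum_univ_two] at hg ⊢
    refine hg.trans ?_
    fin_cases i <;> fin_cases j <;> rfl
  inv_val := by
    ext i j : 1
    refine FiniteAdeleRing.ext _ fun p => ?_
    have hg := congrFun (congrFun (g p).inv_val i) j
    rw [Matrix.mul_apply, Fin.sum_univ_two] at hg ⊢
    refine hg.trans ?_
    fin_cases i <;> fin_cases j <;> rfl

/-- The local component of `η_𝔏`: `(0 1; ϖ_𝔭 ^ n_𝔭 0)` if `𝔭 ∣ 𝔏` and `1` otherwise. -/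
def etaLocal (ϖ : Uniformizers F) (𝔫 𝔏 : Ideal (𝓞 F)) (p : HeightOneSpectrum (𝓞 F)) :
    GL (Fin 2) (p.adicCompletion F) :=
  open Classical in if p.asIdeal ∣ 𝔏 then antiMat (ϖ.unit p ^ ordAt 𝔫 p) else 1

theorem etaLocal_eventually_mem (ϖ : Uniformizers F) (𝔫 𝔏 : Ideal (𝓞 F)) :
    ∀ᶠ p in Filter.cofinite, etaLocal ϖ 𝔫 𝔏 p ∈ KFin p := by
  filter_upwards [ordAt_eventually_eq_zero 𝔫] with p hp
  unfold etaLocal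
  split_ifs
  · rw [hp, pow_zero]
    refine ⟨antiMat 1, ?_⟩
    ext i j
    fin_cases i <;> fin_cases j <;> simp [antiMat]
  · exact one_mem _

/-- The element `η_𝔏` of `GL₂(𝔸_F)`; its archimedean components are `1`. -/
def eta (ϖ : Uniformizers F) (𝔫 𝔏 : Ideal (𝓞 F)) : GL (Fin 2) (Adele F) :=
  glPair 1 (finOfLocal (etaLocal ϖ 𝔫 𝔏) (etaLocal_eventually_mem ϖ 𝔫 𝔏))

/-! ### The generating domain for square-free level -/

/-- The group `K^*` for the square-free ideal `𝔞`, with components in `Z(F_ν) K_ν` at the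
archimedean places, in `Z(F_𝔭) K_𝔭` at `𝔭 ∤ 𝔞`, and in the group generated by `K_{0,𝔭}(1)` and
`(0 1; ϖ_𝔭 0)` at `𝔭 ∣ 𝔞`. -/
def KStar (ϖ : Uniformizers F) (𝔞 : Ideal (𝓞 F)) : Set (GL (Fin 2) (Adele F)) :=
  {g | (∀ v, ∃ (z : v.Completionˣ), ∃ k ∈ KInf v, compInf v g = zMat z * k) ∧
    (∀ p : HeightOneSpectrum (𝓞 F), ¬ p.asIdeal ∣ 𝔞 →
      ∃ (z : (p.adicCompletion F)ˣ), ∃ k ∈ KFin p, compFin p (finPart g) = zMat z * k) ∧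
    ∀ p : HeightOneSpectrum (𝓞 F), p.asIdeal ∣ 𝔞 →
      compFin p (finPart g) ∈ Subgroup.closure (K0Fin p 1 ∪ {antiMat (ϖ.unit p)})}

/-- The special matrix `(y x; 0 1) a(θ_i)` with `(y x; 0 1)` in `B(F_∞)`. -/
def special (θ : Fin (NumberField.classNumber F) → (FinAdele F)ˣ)
    (y : (InfiniteAdeleRing F)ˣ) (x : InfiniteAdeleRing F)
    (i : Fin (NumberField.classNumber F)) : GL (Fin 2) (Adele F) :=
  glPair (bMat y x) (aMat (θ i))

/-- The generating domain `ℱ(𝔞)` for `GL₂(F) \ GL₂(𝔸_F) / K^*`: the special matrices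
`(y x; 0 1) a(θ_i)` for which `|y|_∞` is maximal among all special matrices in the same double
coset. The norm of Mathlib on `F_∞` is the modulus `∏_ν |y_ν| ^ [F_ν : ℝ]`. -/
def genDomain (ϖ : Uniformizers F) (θ : Fin (NumberField.classNumber F) → (FinAdele F)ˣ)
    (𝔞 : Ideal (𝓞 F)) : Set (GL (Fin 2) (Adele F)) :=
  {g | ∃ y x i, g = special θ y x i ∧ ∀ y' x' i',
    (∃ γ : GL (Fin 2) F, ∃ k ∈ KStar ϖ 𝔞, special θ y' x' i' = rational γ * g * k) →
      ‖(y' : InfiniteAdeleRing F)‖ ≤ ‖(y : InfiniteAdeleRing F)‖}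

/-- `ℱ_𝔞`: the matrices `(y x; 0 1)` in `GL₂(F_∞)` with `(y x; 0 1) a(θ_i) ∈ ℱ(𝔞)` for some `i`. -/
def calF (ϖ : Uniformizers F) (θ : Fin (NumberField.classNumber F) → (FinAdele F)ˣ)
    (𝔞 : Ideal (𝓞 F)) : Set (GL (Fin 2) (InfiniteAdeleRing F)) :=
  {b | ∃ y x, b = bMat y x ∧ ∃ i, glPair b (aMat (θ i)) ∈ genDomain ϖ θ 𝔞}

/-! ### Forms of level `𝔫` and their twists -/

/-- The transformation rules of a newform of level `𝔫` with unitary central character `ω`. -/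
structure IsFormOfLevel (φ : GL (Fin 2) (Adele F) → ℂ) (ω : (Adele F)ˣ →* Circle)
    (𝔫 : Ideal (𝓞 F)) : Prop where
  left_invariant : ∀ (γ : GL (Fin 2) F) g, φ (rational γ * g) = φ g
  central : ∀ z g, φ (zMat z * g) = (ω z : ℂ) * φ g
  right_invariant : ∀ g, ∀ k ∈ K1 𝔫, φ (g * k) = φ g

/-- `χ` is a twisting character `ω^𝔏`: on `∏ 𝔬_𝔭ˣ`, it is trivial at the places `𝔭 ∣ 𝔏` and agrees
with `ω` at the places `𝔭 ∤ 𝔏`. -/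
def IsTwistCharacter (ω : (Adele F)ˣ →* Circle) (𝔏 : Ideal (𝓞 F)) (χ : (Adele F)ˣ →* Circle) :
    Prop :=
  ∀ u : (Adele F)ˣ, (∀ v : InfinitePlace F, evalInf v (u : Adele F) = 1) →
    (∀ p : HeightOneSpectrum (𝓞 F), Valued.v (evalFin p (projFin (u : Adele F))) = 1) →
    ((∀ p : HeightOneSpectrum (𝓞 F), ¬ p.asIdeal ∣ 𝔏 →
      evalFin p (projFin (u : Adele F)) = 1) → χ u = 1) ∧
    ((∀ p : HeightOneSpectrum (𝓞 F), p.asIdeal ∣ 𝔏 →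
      evalFin p (projFin (u : Adele F)) = 1) → χ u = ω u)

/-- The twisted form `φ^𝔏(g) = ω⁻¹ω^𝔏(det g) φ(g η_𝔏)`, where `χ = ω^𝔏`. -/
def twist (ϖ : Uniformizers F) (𝔫 𝔏 : Ideal (𝓞 F)) (ω χ : (Adele F)ˣ →* Circle)
    (φ : GL (Fin 2) (Adele F) → ℂ) : GL (Fin 2) (Adele F) → ℂ :=
  fun g => (((ω (Matrix.GeneralLinearGroup.det g))⁻¹ * χ (Matrix.GeneralLinearGroup.det g) :
    Circle) : ℂ) * φ (g * eta ϖ 𝔫 𝔏)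

end

end AdelicGL2

open AdelicGL2

/-!
Multiply `g` on the right by the inverse of the matrix with component `(0 1; ϖ_𝔭 ^ n_{1,𝔭} 0)` at
each finite place `𝔭`. If the product is decomposed with respect to `G(F)`, `ℱ(𝔫₂)` and `K^*` and
the factor in `K^*` is multiplied back, then each local component `κ_𝔭 (0 1; ϖ_𝔭 ^ n_{1,𝔭} 0)`
becomes an element of `𝒥_𝔫` at `𝔭`, up to the centre and `K_{1,𝔭}(n_𝔭)`. For `𝔭 ∣ 𝔫₂` this uses
`κ_𝔭 ∈ Z K_{0,𝔭}(1)` or `κ_𝔭 ∈ Z K_{0,𝔭}(1) (0 1; ϖ_𝔭 0)⁻¹`; the places of the second kind make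
up `𝔏`.

Every double coset in `G(F) \ G(𝔸) / K^*` contains a special matrix: `SL₂(𝔸_fin)` is generated by
unipotent elements, so strong approximation for it reduces to that for `𝔸_fin`; determinants are
accounted for by the representatives `θ_i` of the class group, and the archimedean components by the
Iwasawa decomposition. If `γ` carries the special matrix with data `(y, x, i)` to the one with data
`(y', x', j)` modulo `K^*`, then comparing the determinant with the norm of the bottom row at every
place and applying the product formula gives
`|y| |θ_i| = |y'| |θ_j| H ∏_{𝔭 ∈ S} |ϖ_𝔭|⁻¹`,
where `H` is the height of the bottom row of `γ`, twisted by the first matrix, and `S` is a set of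
primes dividing `𝔫₂`. If `|y| ≤ |y'|`, then `H` is bounded, which by Northcott leaves finitely many
rows up to scaling. So only finitely many values `|y'| ≥ |y|` occur and the maximum exists.
-/

namespace AdelicGL2

/-! ### Local matrix groups -/

section Ring

variable {R S : Type*} [CommRing R] [CommRing S]

@[simp] theorem val_aMat (y : Rˣ) : (aMat y).val = !![(y : R), 0; 0, 1] := rfl

@[simp] theorem val_nMat (x : R) : (nMat x).val = !![1, x; 0, 1] := rfl

@[simp] theorem val_antiMat (u : Rˣ) : (antiMat u).val = !![0, 1; (u : R), 0] := rfl

theorem val_inv_antiMat (u : Rˣ) :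
    (antiMat u)⁻¹.val = !![0, ((u⁻¹ : Rˣ) : R); 1, 0] := rfl

@[simp] theorem val_weyl : (weyl : GL (Fin 2) R).val = !![0, 1; -1, 0] := by
  simp [weyl]

@[simp] theorem val_zMat (r : Rˣ) : (zMat r).val = !![(r : R), 0; 0, (r : R)] := by
  ext i j
  fin_cases i <;> fin_cases j <;> simp [zMat]

@[simp] theorem val_bMat (y : Rˣ) (x : R) : (bMat y x).val = !![(y : R), x; 0, 1] := by
  simp [bMat]

theorem zMat_comm (r : Rˣ) (g : GL (Fin 2) R) : zMat r * g = g * zMat r :=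
  Matrix.GeneralLinearGroup.scalar_commute r g

theorem zMat_mul (r s : Rˣ) : zMat (r * s) = zMat r * zMat s := map_mul _ _ _

theorem zMat_one : zMat (1 : Rˣ) = 1 := map_one _

theorem zMat_inv (r : Rˣ) : zMat r⁻¹ = (zMat r)⁻¹ := map_inv _ _

theorem nMat_add (x y : R) : nMat (x + y) = nMat x * nMat y := by
  apply Units.ext
  simp [add_comm]

theorem antiMat_mul_self (u : Rˣ) : antiMat u * antiMat u = zMat u := by
  apply Units.ext
  simp

theorem antiMat_conj (u : Rˣ) (g : GL (Fin 2) R) :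
    (antiMat u * g * (antiMat u)⁻¹).val =
      !![g.val 1 1, g.val 1 0 * ((u⁻¹ : Rˣ) : R); g.val 0 1 * u, g.val 0 0] := by
  rw [Units.val_mul, Units.val_mul, val_inv_antiMat, val_antiMat, Matrix.eta_fin_two g.val,
    Matrix.mul_fin_two, Matrix.mul_fin_two]
  ext i j
  fin_cases i <;> fin_cases j <;> simp [mul_comm, mul_left_comm]

theorem map_aMat (f : R →+* S) (y : Rˣ) :
    Matrix.GeneralLinearGroup.map f (aMat y) = aMat (Units.map (f : R →* S) y) := by
  ext i j
  fin_cases i <;> fin_cases j <;> simp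

theorem map_nMat (f : R →+* S) (x : R) :
    Matrix.GeneralLinearGroup.map f (nMat x) = nMat (f x) := by
  ext i j
  fin_cases i <;> fin_cases j <;> simp

theorem map_weyl (f : R →+* S) :
    Matrix.GeneralLinearGroup.map f (weyl : GL (Fin 2) R) = weyl := by
  ext i j
  fin_cases i <;> fin_cases j <;> simp

theorem map_zMat (f : R →+* S) (r : Rˣ) :
    Matrix.GeneralLinearGroup.map f (zMat r) = zMat (Units.map (f : R →* S) r) := by
  ext i j
  fin_cases i <;> fin_cases j <;> simp

theorem map_bMat (f : R →+* S) (y : Rˣ) (x : R) :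
    Matrix.GeneralLinearGroup.map f (bMat y x) = bMat (Units.map (f : R →* S) y) (f x) := by
  simp only [bMat, map_mul, map_aMat, map_nMat]

/-- The subgroup `Z(R) H` of `GL₂(R)`; the groups occurring in `KStar` are of this shape. -/
def centerMul (H : Subgroup (GL (Fin 2) R)) : Subgroup (GL (Fin 2) R) where
  carrier := {g | ∃ z : Rˣ, ∃ k ∈ H, g = zMat z * k}
  one_mem' := ⟨1, 1, one_mem H, by rw [zMat_one, one_mul]⟩
  mul_mem' := by
    rintro _ _ ⟨z, k, hk, rfl⟩ ⟨z', k', hk', rfl⟩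
    refine ⟨z * z', k * k', mul_mem hk hk', ?_⟩
    rw [zMat_mul, mul_assoc, ← mul_assoc k, ← zMat_comm]
    simp only [mul_assoc]
  inv_mem' := by
    rintro _ ⟨z, k, hk, rfl⟩
    exact ⟨z⁻¹, k⁻¹, inv_mem hk, by rw [_root_.mul_inv_rev, ← zMat_inv, zMat_comm]⟩

theorem mem_centerMul {H : Subgroup (GL (Fin 2) R)} {g : GL (Fin 2) R} :
    g ∈ centerMul H ↔ ∃ z : Rˣ, ∃ k ∈ H, g = zMat z * k := Iff.rfl

theorem le_centerMul (H : Subgroup (GL (Fin 2) R)) : H ≤ centerMul H :=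
  fun k hk => ⟨1, k, hk, by rw [zMat_one, one_mul]⟩

theorem zMat_mem_centerMul (H : Subgroup (GL (Fin 2) R)) (z : Rˣ) : zMat z ∈ centerMul H :=
  ⟨z, 1, one_mem H, (mul_one _).symm⟩

theorem conj_mem_centerMul {H : Subgroup (GL (Fin 2) R)} {A : GL (Fin 2) R}
    (hA : ∀ k ∈ H, A * k * A⁻¹ ∈ H) : ∀ g ∈ centerMul H, A * g * A⁻¹ ∈ centerMul H := by
  rintro _ ⟨z, k, hk, rfl⟩
  exact ⟨z, _, hA k hk, by rw [← mul_assoc, ← zMat_comm]; simp only [mul_assoc]⟩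

end Ring

theorem eq_zMat_mul_nMat_mul_weyl_mul {K : Type*} [Field K] {g k : GL (Fin 2) K} {r υ s : K}
    {t : Kˣ} (hk : k.val = !![1, r; 0, υ]) (hc : g.val 1 0 ≠ 0)
    (hdet : g.val.det / g.val 1 0 ^ 2 = t * υ) (hrow : g.val 1 1 = g.val 1 0 * (s * υ + r)) :
    g = zMat (Units.mk0 (-g.val 1 0) (neg_ne_zero.2 hc)) * nMat (g.val 0 0 / g.val 1 0) *
      (aMat t * weyl * nMat s) * k := by
  apply Units.ext
  rw [Matrix.det_fin_two] at hdet
  ext i j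
  fin_cases i <;> fin_cases j <;> simp [Matrix.mul_apply, Fin.sum_univ_two, hk]
  · field_simp
  · field_simp at hdet ⊢
    refine mul_left_cancel₀ hc ?_
    linear_combination g.val 0 0 * hrow - hdet
  · linear_combination hrow

theorem bottomRow_ne_zero {K : Type*} [Field K] (g : GL (Fin 2) K) :
    g.val 1 0 ≠ 0 ∨ g.val 1 1 ≠ 0 := by
  by_contra! h
  exact g.det_ne_zero (by rw [Matrix.det_fin_two, h.1, h.2, mul_zero, mul_zero, sub_zero])

theorem mem_or_mul_mem_of_mem_closure_union_singleton {G : Type*} [Group G] {N : Subgroup G} {a : G}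
    (hconj : ∀ n ∈ N, a * n * a⁻¹ ∈ N) (hsq : a * a ∈ N) {g : G}
    (hg : g ∈ Subgroup.closure ((N : Set G) ∪ {a})) : g ∈ N ∨ g * a ∈ N := by
  have hconj' : ∀ n ∈ N, a⁻¹ * n * a ∈ N := fun n hn => by
    convert mul_mem (mul_mem (inv_mem hsq) (hconj n hn)) hsq using 1
    group
  induction hg using Subgroup.closure_induction with
  | mem x hx => exact hx.imp id fun h => by rwa [Set.mem_singleton_iff.1 h]
  | one => exact Or.inl (one_mem N)
  | mul x y _ _ hx hy =>
    rcases hx with hx | hx <;> rcases hy with hy | hy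
    · exact Or.inl (mul_mem hx hy)
    · exact Or.inr (by rw [mul_assoc]; exact mul_mem hx hy)
    · exact Or.inr (by convert mul_mem hx (hconj' y hy) using 1; group)
    · refine Or.inl ?_
      convert mul_mem (mul_mem hx (hconj' _ hy)) (inv_mem hsq) using 1
      group
  | inv x _ hx =>
    refine hx.imp inv_mem fun hx => ?_
    convert mul_mem (hconj _ (inv_mem hx)) hsq using 1
    group

section Local

variable {F : Type*} [Field F] [NumberField F] {p : HeightOneSpectrum (𝓞 F)}

theorem mem_KFin_iff {g : GL (Fin 2) (p.adicCompletion F)} :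
    g ∈ KFin p ↔ (∀ i j, Valued.v (g.val i j) ≤ 1) ∧ Valued.v g.val.det = 1 := by
  have val_det (A : Matrix (Fin 2) (Fin 2) (p.adicCompletionIntegers F)) :
      (A.map (algebraMap _ (p.adicCompletion F))).det = A.det := (RingHom.map_det _ _).symm
  constructor
  · rintro ⟨k, rfl⟩
    refine ⟨fun i j => (k.val i j).2, ?_⟩
    have hk : IsUnit k.val.det := (Matrix.isUnit_iff_isUnit_det _).1 k.isUnit
    rw [HeightOneSpectrum.adicCompletionIntegers.isUnit_iff_valued_eq_one] at hk
    exact (congrArg Valued.v (val_det k.val)).trans hk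
  · rintro ⟨hentry, hdet⟩
    let A : Matrix (Fin 2) (Fin 2) (p.adicCompletionIntegers F) :=
      Matrix.of fun i j => ⟨g.val i j, hentry i j⟩
    have hA : IsUnit A.det := by
      rw [HeightOneSpectrum.adicCompletionIntegers.isUnit_iff_valued_eq_one, ← val_det]
      exact hdet
    exact ⟨Matrix.GeneralLinearGroup.mk'' A hA, Units.ext rfl⟩

theorem valued_det_conj {g h : GL (Fin 2) (p.adicCompletion F)} :
    Valued.v (h * g * h⁻¹).val.det = Valued.v g.val.det := by
  rw [Units.val_mul, Units.val_mul, Matrix.det_units_conj]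

theorem val_inv_fin_two {K : Type*} [Field K] (g : GL (Fin 2) K) :
    g⁻¹.val = g.val.det⁻¹ • !![g.val 1 1, -g.val 0 1; -g.val 1 0, g.val 0 0] := by
  rw [Matrix.coe_units_inv, Matrix.inv_def, Matrix.adjugate_fin_two, Ring.inverse_eq_inv']

/-- `K_{0,𝔭}(n)` as a subgroup of `GL₂(F_𝔭)`. -/
def K0Subgroup (p : HeightOneSpectrum (𝓞 F)) (n : ℕ) :
    Subgroup (GL (Fin 2) (p.adicCompletion F)) where
  carrier := K0Fin p n
  one_mem' := ⟨one_mem _, by simp⟩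
  mul_mem' {g h} hg hh := by
    refine ⟨mul_mem hg.1 hh.1, ?_⟩
    rw [Units.val_mul, Matrix.mul_apply, Fin.sum_univ_two]
    refine (Valuation.map_add _ _ _).trans (max_le ?_ ?_) <;> rw [map_mul]
    · exact mul_le_of_le_of_le_one hg.2 ((mem_KFin_iff.1 hh.1).1 _ _)
    · exact mul_le_of_le_one_of_le ((mem_KFin_iff.1 hg.1).1 _ _) hh.2
  inv_mem' {g} hg := by
    refine ⟨inv_mem hg.1, ?_⟩
    rw [val_inv_fin_two]
    simpa [(mem_KFin_iff.1 hg.1).2] using hg.2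

theorem valued_diag_of_mem_K0Fin {n : ℕ} (hn : 1 ≤ n) {g : GL (Fin 2) (p.adicCompletion F)}
    (hg : g ∈ K0Fin p n) : Valued.v (g.val 0 0) = 1 ∧ Valued.v (g.val 1 1) = 1 := by
  obtain ⟨hentry, hdet⟩ := mem_KFin_iff.1 hg.1
  have hlower : Valued.v (g.val 1 0) < 1 := by
    refine hg.2.trans_lt ?_
    rw [← WithZero.exp_zero, WithZero.exp_lt_exp]
    omega
  have hdiag : Valued.v (g.val 0 0) * Valued.v (g.val 1 1) = 1 := by
    have hsum : g.val 0 0 * g.val 1 1 = g.val.det + g.val 0 1 * g.val 1 0 := by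
      rw [Matrix.det_fin_two]; ring
    rw [← map_mul, hsum, Valuation.map_add_eq_of_lt_left, hdet]
    rw [hdet, map_mul]
    exact mul_lt_one_of_nonneg_of_lt_one_right (hentry _ _) zero_le hlower
  exact ⟨eq_one_of_one_le_mul_left (hentry _ _) (hentry _ _) hdiag.ge,
    eq_one_of_one_le_mul_right (hentry _ _) (hentry _ _) hdiag.ge⟩

variable (ϖ : Uniformizers F)

theorem valued_unit (p : HeightOneSpectrum (𝓞 F)) :
    Valued.v ((ϖ.unit p : (p.adicCompletion F)ˣ) : p.adicCompletion F)
      = WithZero.exp (-1 : ℤ) := (ϖ p).2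

theorem valued_unit_zpow (p : HeightOneSpectrum (𝓞 F)) (t : ℤ) :
    Valued.v ((ϖ.unit p ^ t : (p.adicCompletion F)ˣ) : p.adicCompletion F)
      = WithZero.exp (-t) := by
  rw [Units.val_zpow_eq_zpow_val, map_zpow₀, valued_unit, ← WithZero.exp_zsmul]
  simp

theorem exists_eq_unit_zpow_mul {x : p.adicCompletion F} (hx : x ≠ 0) :
    ∃ (t : ℤ) (υ : p.adicCompletion F), Valued.v υ = 1 ∧
      x = ((ϖ.unit p ^ t : (p.adicCompletion F)ˣ) : p.adicCompletion F) * υ := by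
  have hv : Valued.v x ≠ 0 := (Valuation.ne_zero_iff _).2 hx
  refine ⟨-WithZero.log (Valued.v x),
    x / ((ϖ.unit p ^ (-WithZero.log (Valued.v x)) : (p.adicCompletion F)ˣ) : p.adicCompletion F),
    ?_, (mul_div_cancel₀ _ (Units.ne_zero _)).symm⟩
  rw [map_div₀, valued_unit_zpow, neg_neg, WithZero.exp_log hv, div_self hv]

theorem antiMat_conj_mem_K0Subgroup {g : GL (Fin 2) (p.adicCompletion F)}
    (hg : g ∈ K0Subgroup p 1) :
    antiMat (ϖ.unit p) * g * (antiMat (ϖ.unit p))⁻¹ ∈ K0Subgroup p 1 := by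
  obtain ⟨hentry, hdet⟩ := mem_KFin_iff.1 hg.1
  have hupper : Valued.v (g.val 1 0 * ((ϖ.unit p)⁻¹ : (p.adicCompletion F)ˣ)) ≤ 1 := by
    rw [map_mul, ← _root_.zpow_neg_one, valued_unit_zpow, neg_neg]
    calc Valued.v (g.val 1 0) * WithZero.exp (1 : ℤ)
        ≤ WithZero.exp (-((1 : ℕ) : ℤ)) * WithZero.exp (1 : ℤ) := by gcongr; exact hg.2
      _ = 1 := by rw [← WithZero.exp_add]; simp
  have hlower : Valued.v (g.val 0 1 * ϖ.unit p) ≤ WithZero.exp (-((1 : ℕ) : ℤ)) := by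
    rw [map_mul, valued_unit]
    exact mul_le_of_le_one_of_le (hentry _ _) (by simp)
  refine ⟨mem_KFin_iff.2 ⟨?_, valued_det_conj.trans hdet⟩, ?_⟩ <;> rw [antiMat_conj]
  · intro i j
    fin_cases i <;> fin_cases j
    · exact hentry 1 1
    · exact hupper
    · exact hlower.trans (by rw [← WithZero.exp_zero, WithZero.exp_le_exp]; simp)
    · exact hentry 0 0
  · exact hlower

theorem mem_or_mul_antiMat_mem_centerMul {g : GL (Fin 2) (p.adicCompletion F)}
    (hg : g ∈ Subgroup.closure (K0Fin p 1 ∪ {antiMat (ϖ.unit p)})) :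
    g ∈ centerMul (K0Subgroup p 1) ∨
      g * antiMat (ϖ.unit p) ∈ centerMul (K0Subgroup p 1) := by
  refine mem_or_mul_mem_of_mem_closure_union_singleton
    (conj_mem_centerMul fun _ => antiMat_conj_mem_K0Subgroup ϖ) ?_
    (Subgroup.closure_mono (Set.union_subset_union_left _ (le_centerMul _)) hg)
  rw [antiMat_mul_self]
  exact zMat_mem_centerMul _ _

theorem mem_localCell_of_row {n l : ℕ} {g : GL (Fin 2) (p.adicCompletion F)}
    (hc : g.val 1 0 ≠ 0) {v r : p.adicCompletion F} (hv : Valued.v v = 1) (hr : Valued.v r ≤ 1)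
    (hrow : g.val 1 1 = g.val 1 0 *
      (((ϖ.unit p ^ (-(l : ℤ)) : (p.adicCompletion F)ˣ) : p.adicCompletion F) * v + r)) :
    g ∈ localCell ϖ p n l := by
  obtain ⟨t, υ, hυ, hdet⟩ := exists_eq_unit_zpow_mul ϖ
    (div_ne_zero g.det_ne_zero (pow_ne_zero 2 hc))
  have hυ0 : υ ≠ 0 := (Valuation.ne_zero_iff Valued.v).1 (by simp [hυ])
  let k : GL (Fin 2) (p.adicCompletion F) :=
    Matrix.GeneralLinearGroup.mkOfDetNeZero !![1, r; 0, υ] (by simpa using hυ0)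
  have hk : k.val = !![1, r; 0, υ] := rfl
  refine ⟨Units.mk0 (-g.val 1 0) (neg_ne_zero.2 hc), g.val 0 0 / g.val 1 0, t, v / υ,
    by rw [map_div₀, hv, hυ, div_one], k, ⟨mem_KFin_iff.2 ⟨fun i j => ?_, ?_⟩, ?_, ?_⟩, ?_⟩
  · fin_cases i <;> fin_cases j <;> simp [hk, hυ, hr]
  · simp [hk, hυ]
  · simp [hk]
  · simp [hk]
  · exact eq_zMat_mul_nMat_mul_weyl_mul hk hc hdet (by rw [hrow]; field_simp)

theorem exists_eq_unit_zpow_neg_mul_add {m : ℕ} {s : p.adicCompletion F}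
    (hs : Valued.v s ≤ WithZero.exp (m : ℤ)) :
    ∃ l ≤ m, ∃ v r : p.adicCompletion F, Valued.v v = 1 ∧ Valued.v r ≤ 1 ∧
      s = ((ϖ.unit p ^ (-(l : ℤ)) : (p.adicCompletion F)ˣ) : p.adicCompletion F) * v + r := by
  by_cases hs1 : Valued.v s ≤ 1
  · refine ⟨0, Nat.zero_le _, 1, s - 1, map_one _, ?_, by simp⟩
    exact (Valuation.map_sub _ _ _).trans (max_le hs1 (by simp))
  · have hs0 : s ≠ 0 := fun h => hs1 (by simp [h])
    obtain ⟨t, υ, hυ, rfl⟩ := exists_eq_unit_zpow_mul ϖ hs0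
    rw [map_mul, valued_unit_zpow, hυ, mul_one, WithZero.exp_le_exp] at hs
    rw [map_mul, valued_unit_zpow, hυ, mul_one, ← WithZero.exp_zero, WithZero.exp_le_exp] at hs1
    obtain ⟨l, hl⟩ := Int.eq_ofNat_of_zero_le (not_le.1 hs1).le
    refine ⟨l, by omega, υ, 0, hυ, by simp, ?_⟩
    rw [add_zero, ← hl, neg_neg]

theorem lInv_le_of_valued_row_le {n m : ℕ} (hm : m ≤ n) {g : GL (Fin 2) (p.adicCompletion F)}
    (hc : g.val 1 0 ≠ 0)
    (hd : Valued.v (g.val 1 1) ≤ Valued.v (g.val 1 0) * WithZero.exp (m : ℤ)) :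
    lInv ϖ p n g ≤ m := by
  have hquot : Valued.v (g.val 1 1 / g.val 1 0) ≤ WithZero.exp (m : ℤ) := by
    rw [map_div₀]
    exact div_le_of_le_mul₀ zero_le zero_le (by rwa [mul_comm])
  obtain ⟨l, hlm, v, r, hv, hr, hs⟩ := exists_eq_unit_zpow_neg_mul_add ϖ hquot
  have hcell : g ∈ localCell ϖ p n l :=
    mem_localCell_of_row ϖ hc hv hr (by rw [← hs, mul_div_cancel₀ _ hc])
  exact (Nat.sInf_le (show l ∈ {l | l ≤ n ∧ g ∈ localCell ϖ p n l} from
    ⟨hlm.trans hm, hcell⟩)).trans hlm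

end Local

/-! ### Ideals and local orders -/

section Dedekind

open HeightOneSpectrum

theorem finprod_asIdeal_pow_eq_prod {R : Type*} [CommRing R] {e : HeightOneSpectrum R → ℕ}
    (he : ∀ᶠ p in Filter.cofinite, e p = 0) :
    ∏ᶠ p : HeightOneSpectrum R, p.asIdeal ^ e p
      = ∏ q ∈ (Filter.eventually_cofinite.1 he).toFinset, q.asIdeal ^ e q := by
  refine finprod_eq_prod_of_mulSupport_subset _ fun p hp => ?_
  rw [Set.Finite.coe_toFinset]
  exact fun (hep : e p = 0) => hp (by simp only [hep, pow_zero])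

variable {R : Type*} [CommRing R] [IsDedekindDomain R]

theorem finprod_asIdeal_pow_ne_zero {e : HeightOneSpectrum R → ℕ}
    (he : ∀ᶠ p in Filter.cofinite, e p = 0) :
    ∏ᶠ p : HeightOneSpectrum R, p.asIdeal ^ e p ≠ 0 := by
  rw [finprod_asIdeal_pow_eq_prod he]
  exact Finset.prod_ne_zero_iff.2 fun q _ => pow_ne_zero _ q.ne_bot

theorem asIdeal_dvd_asIdeal_iff {p q : HeightOneSpectrum R} :
    p.asIdeal ∣ q.asIdeal ↔ p = q := by
  refine ⟨fun h => HeightOneSpectrum.ext ?_, fun h => h ▸ dvd_rfl⟩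
  exact (q.isMaximal.eq_of_le p.isPrime.ne_top (Ideal.dvd_iff_le.1 h)).symm

theorem asIdeal_dvd_finprod_pow_iff {e : HeightOneSpectrum R → ℕ}
    (he : ∀ᶠ p in Filter.cofinite, e p = 0) (p : HeightOneSpectrum R) :
    p.asIdeal ∣ ∏ᶠ q : HeightOneSpectrum R, q.asIdeal ^ e q ↔ e p ≠ 0 := by
  rw [finprod_asIdeal_pow_eq_prod he, p.prime.dvd_finsetProd_iff]
  constructor
  · rintro ⟨q, hq, hpq⟩
    rw [asIdeal_dvd_asIdeal_iff.1 (p.prime.dvd_of_dvd_pow hpq)]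
    simpa using hq
  · exact fun hp => ⟨p, by simpa using hp, dvd_pow_self _ hp⟩

theorem exists_dvd_forall_asIdeal_dvd_iff_mem {I : Ideal R} (hI : I ≠ 0)
    {T : Set (HeightOneSpectrum R)} (hT : ∀ p ∈ T, p.asIdeal ∣ I) :
    ∃ J : Ideal R, J ∣ I ∧ ∀ p : HeightOneSpectrum R, p.asIdeal ∣ J ↔ p ∈ T := by
  have hfin : T.Finite := (Ideal.finite_factors hI).subset hT
  refine ⟨∏ q ∈ hfin.toFinset, q.asIdeal, Finset.prod_dvd_of_isRelPrime ?_ (by simpa using hT),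
    fun p => ?_⟩
  · exact fun p _ q _ hpq => p.irreducible.isRelPrime_iff_not_dvd.2
      (mt asIdeal_dvd_asIdeal_iff.1 hpq)
  · simp [p.prime.dvd_finsetProd_iff, asIdeal_dvd_asIdeal_iff]

theorem exists_intValuation_le {e : HeightOneSpectrum R → ℕ}
    (he : ∀ᶠ p in Filter.cofinite, e p = 0) :
    ∃ r : R, r ≠ 0 ∧ ∀ p : HeightOneSpectrum R,
      p.intValuation r ≤ WithZero.exp (-(e p : ℤ)) := by
  obtain ⟨r, hr, hr0⟩ := Submodule.exists_mem_ne_zero_of_ne_bot (finprod_asIdeal_pow_ne_zero he)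
  rw [finprod_asIdeal_pow_eq_prod he] at hr
  refine ⟨r, hr0, fun p => (p.intValuation_le_pow_iff_mem r (e p)).2 ?_⟩
  by_cases hp : e p = 0
  · simp [hp]
  · exact Ideal.dvd_iff_le.1 (Finset.dvd_prod_of_mem (fun q => q.asIdeal ^ e q)
      ((Set.Finite.mem_toFinset _).2 hp)) hr

variable {K : Type*} [Field K] [Algebra R K] [IsFractionRing R K]

theorem valued_algebraMap (p : HeightOneSpectrum R) (a : K) :
    Valued.v (algebraMap K (p.adicCompletion K) a) = p.valuation K a :=
  valuedAdicCompletion_eq_valuation' p a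

theorem valued_algebraMap_algebraMap (p : HeightOneSpectrum R) (r : R) :
    Valued.v (algebraMap K (p.adicCompletion K) (algebraMap R K r)) = p.intValuation r := by
  rw [valued_algebraMap, valuation_of_algebraMap]

theorem setOf_valued_sub_lt_exp_mem_nhds (p : HeightOneSpectrum R) (y : p.adicCompletion K)
    (m : ℤ) : {b | Valued.v (b - y) < WithZero.exp m} ∈ nhds y := by
  obtain ⟨c, hc⟩ := valuedAdicCompletion_surjective K p (WithZero.exp m)
  have hc0 : c ≠ 0 := (Valuation.ne_zero_iff Valued.v).1 (hc ▸ WithZero.exp_ne_zero)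
  refine Valued.mem_nhds.2
    ⟨Units.mk0 (Valued.v.restrict c) ((Valuation.ne_zero_iff _).2 hc0), fun b hb => ?_⟩
  rw [Set.mem_ofPred_eq, ← hc]
  exact (Valuation.restrict_lt_iff _).1 hb

theorem exists_algebraMap_valued_sub_le (p : HeightOneSpectrum R) {y : p.adicCompletion K}
    (hy : Valued.v y ≤ 1) (m : ℕ) : ∃ r : R,
      Valued.v (y - algebraMap K (p.adicCompletion K) (algebraMap R K r))
        ≤ WithZero.exp (-(m : ℤ)) := by
  obtain ⟨a, ha⟩ := (denseRange_algebraMap K p).mem_nhds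
    (setOf_valued_sub_lt_exp_mem_nhds p y (-(m : ℤ)))
  have ha' : Valued.v (y - algebraMap K (p.adicCompletion K) a) ≤ WithZero.exp (-(m : ℤ)) := by
    rw [Valuation.map_sub_swap]
    exact le_of_lt ha
  have hva : p.valuation K a ≤ 1 := by
    rw [← valued_algebraMap, ← sub_sub_cancel y (algebraMap K (p.adicCompletion K) a)]
    refine (Valuation.map_sub _ _ _).trans (max_le hy (ha'.trans ?_))
    rw [← WithZero.exp_zero, WithZero.exp_le_exp]
    omega
  obtain ⟨r, hr⟩ := exists_valuation_sub_lt_of_integer p hva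
    (Units.mk0 (WithZero.exp (-(m : ℤ))) WithZero.exp_ne_zero)
  refine ⟨r, ?_⟩
  rw [← sub_sub_sub_cancel_right _ _ (algebraMap K (p.adicCompletion K) a), ← map_sub]
  refine (Valuation.map_sub _ _ _).trans (max_le ha' ?_)
  rw [valued_algebraMap]
  exact hr.le

theorem exists_forall_valued_le (x : FiniteAdeleRing R K) : ∃ e : HeightOneSpectrum R → ℕ,
    (∀ᶠ p in Filter.cofinite, e p = 0) ∧ ∀ p, Valued.v (x p) ≤ WithZero.exp (e p : ℤ) := by
  refine ⟨fun p => (WithZero.log (Valued.v (x p))).toNat, ?_, fun p => ?_⟩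
  · filter_upwards [x.2] with p (hp : Valued.v (x p) ≤ 1)
    rw [Int.toNat_eq_zero]
    obtain h0 | h0 := eq_or_ne (Valued.v (x p)) 0
    · rw [h0, WithZero.log_zero]
    · rwa [WithZero.log_le_iff_le_exp h0, WithZero.exp_zero]
  · exact WithZero.le_exp_of_log_le (Int.self_le_toNat _)

theorem exists_forall_algebraMap_valued_sub_le {x : FiniteAdeleRing R K}
    (hx : ∀ p, Valued.v (x p) ≤ 1) {e : HeightOneSpectrum R → ℕ}
    (he : ∀ᶠ p in Filter.cofinite, e p = 0) : ∃ r : R, ∀ p,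
      Valued.v (x p - algebraMap K (p.adicCompletion K) (algebraMap R K r))
        ≤ WithZero.exp (-(e p : ℤ)) := by
  choose r hr using fun p => exists_algebraMap_valued_sub_le p (hx p) (e p)
  obtain ⟨s, hs⟩ := exists_forall_sub_mem_ideal
    (s := (Filter.eventually_cofinite.1 he).toFinset)
    (fun p : HeightOneSpectrum R => p.asIdeal) e (fun p _ => p.prime)
    (fun p _ q _ hpq h => hpq (HeightOneSpectrum.ext h)) (fun p => r p)
  refine ⟨s, fun p => ?_⟩
  by_cases hp : e p = 0
  · rw [hp]
    refine (Valuation.map_sub _ _ _).trans (max_le (by simpa using hx p) ?_)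
    rw [valued_algebraMap_algebraMap]
    simpa using p.intValuation_le_one s
  · have hsp := hs p ((Set.Finite.mem_toFinset _).2 hp)
    rw [← sub_sub_sub_cancel_right _ _ (algebraMap K (p.adicCompletion K) (algebraMap R K (r p))),
      ← map_sub, ← map_sub]
    refine (Valuation.map_sub _ _ _).trans (max_le (hr p) ?_)
    rw [valued_algebraMap_algebraMap]
    exact (p.intValuation_le_pow_iff_mem _ _).2 hsp

theorem exists_forall_valued_sub_algebraMap_le (x : FiniteAdeleRing R K)
    {e : HeightOneSpectrum R → ℕ} (he : ∀ᶠ p in Filter.cofinite, e p = 0) :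
    ∃ a : K, ∀ p, Valued.v (x p - algebraMap K (p.adicCompletion K) a)
      ≤ WithZero.exp (-(e p : ℤ)) := by
  obtain ⟨d, hd, hxd⟩ := exists_forall_valued_le x
  obtain ⟨N, hN0, hN⟩ := exists_intValuation_le hd
  have hNK : algebraMap R K N ≠ 0 := by simpa using hN0
  obtain ⟨d', hd', hNd'⟩ := exists_forall_valued_le
    (algebraMap K (FiniteAdeleRing R K) (algebraMap R K N)⁻¹)
  have hNx (p : HeightOneSpectrum R) :
      Valued.v ((algebraMap K (FiniteAdeleRing R K) (algebraMap R K N) * x) p) ≤ 1 := by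
    calc Valued.v (algebraMap K (p.adicCompletion K) (algebraMap R K N) * x p)
        ≤ WithZero.exp (-(d p : ℤ)) * WithZero.exp (d p : ℤ) := by
          rw [map_mul, valued_algebraMap_algebraMap]
          exact mul_le_mul' (hN p) (hxd p)
      _ = 1 := by rw [← WithZero.exp_add]; simp
  have hsum : ∀ᶠ p in Filter.cofinite, e p + d' p = 0 := by
    filter_upwards [he, hd'] with p hp hp'
    rw [hp, hp']
  obtain ⟨r, hr⟩ := exists_forall_algebraMap_valued_sub_le hNx hsum
  refine ⟨algebraMap R K r * (algebraMap R K N)⁻¹, fun p => ?_⟩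
  let ι : K →+* p.adicCompletion K := algebraMap K (p.adicCompletion K)
  calc Valued.v (x p - ι (algebraMap R K r * (algebraMap R K N)⁻¹))
      = Valued.v (ι (algebraMap R K N) * x p - ι (algebraMap R K r)) *
          Valued.v (ι (algebraMap R K N)⁻¹) := by
        have hιN : ι (algebraMap R K N) ≠ 0 := (map_ne_zero ι).2 hNK
        rw [← map_mul, map_mul, map_inv₀]
        congr 1
        field_simp
    _ ≤ WithZero.exp (-((e p + d' p : ℕ) : ℤ)) * WithZero.exp (d' p : ℤ) :=
        mul_le_mul' (hr p) (hNd' p)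
    _ = WithZero.exp (-(e p : ℤ)) := by
        rw [← WithZero.exp_add]
        push_cast
        ring_nf

end Dedekind

section ClassRepresentatives

variable {F : Type*} [Field F] [NumberField F]

theorem asIdeal_dvd_iff_ordAt_ne_zero {I : Ideal (𝓞 F)} (hI : I ≠ 0)
    (p : HeightOneSpectrum (𝓞 F)) : p.asIdeal ∣ I ↔ ordAt I p ≠ 0 :=
  (Associates.count_ne_zero_iff_dvd hI p.irreducible).symm

theorem ordAt_mul {I J : Ideal (𝓞 F)} (hI : I ≠ 0) (hJ : J ≠ 0) (p : HeightOneSpectrum (𝓞 F)) :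
    ordAt (I * J) p = ordAt I p + ordAt J p := by
  classical
  rw [ordAt, ← Associates.mk_mul_mk]
  exact Associates.count_mul (Associates.mk_ne_zero.2 hI) (Associates.mk_ne_zero.2 hJ)
    p.associates_irreducible

theorem intValuation_eq_exp_ordAt_span (p : HeightOneSpectrum (𝓞 F)) {r : 𝓞 F} (hr : r ≠ 0) :
    p.intValuation r = WithZero.exp (-(ordAt (Ideal.span {r}) p : ℤ)) := by
  classical
  rw [HeightOneSpectrum.intValuation_if_neg _ hr, ordAt]

theorem ordAt_finprod_asIdeal_pow {e : HeightOneSpectrum (𝓞 F) → ℕ}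
    (he : ∀ᶠ p in Filter.cofinite, e p = 0) (p : HeightOneSpectrum (𝓞 F)) :
    ordAt (∏ᶠ q : HeightOneSpectrum (𝓞 F), q.asIdeal ^ e q) p = e p := by
  classical
  have hfin : (Function.mulSupport fun q : HeightOneSpectrum (𝓞 F) => q.asIdeal ^ e q).Finite :=
    (Filter.eventually_cofinite.1 he).subset fun q hq (heq : e q = 0) =>
      hq (by simp only [heq, pow_zero])
  have hcoe : (((∏ᶠ q : HeightOneSpectrum (𝓞 F), q.asIdeal ^ e q : Ideal (𝓞 F))) :
      FractionalIdeal (𝓞 F)⁰ F) = ∏ᶠ q : HeightOneSpectrum (𝓞 F),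
        (q.asIdeal : FractionalIdeal (𝓞 F)⁰ F) ^ (e q : ℤ) := by
    refine ((FractionalIdeal.coeIdealHom (𝓞 F)⁰ F).toMonoidHom.map_finprod hfin).trans ?_
    exact finprod_congr fun q =>
      ((FractionalIdeal.coeIdealHom (𝓞 F)⁰ F).map_pow _ _).trans (zpow_natCast _ _).symm
  have hcount := FractionalIdeal.count_coe F p (finprod_asIdeal_pow_ne_zero he)
  rw [hcoe, FractionalIdeal.count_finprod F p _ (by simpa using he)] at hcount
  exact_mod_cast hcount.symm

theorem exists_intValuation_mul_valued_eq_exp_ordAt (δ : (FinAdele F)ˣ) :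
    ∃ N : 𝓞 F, N ≠ 0 ∧ ∃ J : Ideal (𝓞 F), J ≠ 0 ∧ ∀ p : HeightOneSpectrum (𝓞 F),
      p.intValuation N * Valued.v ((δ : FinAdele F) p) = WithZero.exp (-(ordAt J p : ℤ)) := by
  have hδ := FiniteAdeleRing.isUnit_iff.1 δ.isUnit
  have hδ0 (p : HeightOneSpectrum (𝓞 F)) : Valued.v ((δ : FinAdele F) p) ≠ 0 :=
    (Valuation.ne_zero_iff _).2 (hδ.1 p)
  obtain ⟨d, hd, hδd⟩ := exists_forall_valued_le (δ : FinAdele F)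
  obtain ⟨N, hN0, hN⟩ := exists_intValuation_le hd
  have hexponent (p : HeightOneSpectrum (𝓞 F)) : ∃ f : ℕ,
      (f : ℤ) = ordAt (Ideal.span {N}) p - WithZero.log (Valued.v ((δ : FinAdele F) p)) := by
    refine ⟨_, Int.toNat_of_nonneg ?_⟩
    have hNp := hN p
    have hδp := (WithZero.log_le_iff_le_exp (hδ0 p)).2 (hδd p)
    rw [intValuation_eq_exp_ordAt_span p hN0, WithZero.exp_le_exp] at hNp
    omega
  choose f hf using hexponent
  have hf0 : ∀ᶠ p in Filter.cofinite, f p = 0 := by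
    filter_upwards [ordAt_eventually_eq_zero (Ideal.span {N}), hδ.2] with p hNp hδp
    have hfp := hf p
    rw [hNp, hδp, WithZero.log_one] at hfp
    omega
  refine ⟨N, hN0, _, finprod_asIdeal_pow_ne_zero hf0, fun p => ?_⟩
  rw [ordAt_finprod_asIdeal_pow hf0, hf, intValuation_eq_exp_ordAt_span p hN0, neg_sub,
    sub_eq_neg_add, WithZero.exp_add, WithZero.exp_log (hδ0 p)]

theorem exists_exp_ordAt_eq_valued_mul {I J : (Ideal (𝓞 F))⁰}
    (hIJ : ClassGroup.mk0 I = ClassGroup.mk0 J) :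
    ∃ α : Fˣ, ∀ p : HeightOneSpectrum (𝓞 F), WithZero.exp (-(ordAt J.1 p : ℤ)) =
      Valued.v (algebraMap F (p.adicCompletion F) α) * WithZero.exp (-(ordAt I.1 p : ℤ)) := by
  obtain ⟨a, b, ha, hb, hab⟩ := ClassGroup.mk0_eq_mk0_iff.1 hIJ
  refine ⟨Units.mk0 (algebraMap (𝓞 F) F a / algebraMap (𝓞 F) F b)
    (div_ne_zero (by simpa using ha) (by simpa using hb)), fun p => ?_⟩
  have hord := congrArg (ordAt · p) hab
  rw [ordAt_mul (by simpa using ha) (nonZeroDivisors.ne_zero I.2),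
    ordAt_mul (by simpa using hb) (nonZeroDivisors.ne_zero J.2)] at hord
  rw [Units.val_mk0, map_div₀, map_div₀, valued_algebraMap_algebraMap,
    valued_algebraMap_algebraMap, intValuation_eq_exp_ordAt_span p ha,
    intValuation_eq_exp_ordAt_span p hb, ← WithZero.exp_sub, ← WithZero.exp_add]
  congr 1
  omega

theorem IsClassRepresentatives.exists_valued_eq_valued_mul
    {θ : Fin (NumberField.classNumber F) → (FinAdele F)ˣ} (hθ : IsClassRepresentatives θ)
    (δ : (FinAdele F)ˣ) :
    ∃ i, ∃ α : Fˣ, ∀ p, Valued.v ((δ : FinAdele F) p) =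
      Valued.v (algebraMap F (p.adicCompletion F) α) * Valued.v ((θ i : FinAdele F) p) := by
  obtain ⟨N, hN0, J, hJ0, hJ⟩ := exists_intValuation_mul_valued_eq_exp_ordAt δ
  obtain ⟨i, ⟨I, hI, hIJ⟩, -⟩ :=
    hθ.existsUnique (ClassGroup.mk0 ⟨J, mem_nonZeroDivisors_of_ne_zero hJ0⟩)
  obtain ⟨α, hα⟩ := exists_exp_ordAt_eq_valued_mul hIJ
  refine ⟨i, α * (Units.mk0 (algebraMap (𝓞 F) F N) (by simpa using hN0))⁻¹, fun p => ?_⟩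
  have hNp : p.intValuation N ≠ 0 := p.intValuation_ne_zero N hN0
  rw [Units.val_mul, Units.val_inv_eq_inv_val, Units.val_mk0, map_mul, map_mul, map_inv₀,
    map_inv₀, valued_algebraMap_algebraMap, hI, mul_right_comm, ← hα, ← hJ]
  field_simp

end ClassRepresentatives

section SquarefreePart

variable {F : Type*} [Field F] [NumberField F]

theorem eventually_ord1_sub_ord0_eq_zero (𝔫 : Ideal (𝓞 F)) :
    ∀ᶠ p in Filter.cofinite, ord1 𝔫 p - ord0 𝔫 p = 0 := by
  filter_upwards [ordAt_eventually_eq_zero 𝔫] with p hp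
  simp [ord1, hp]

theorem sqfreePart_ne_zero (𝔫 : Ideal (𝓞 F)) : sqfreePart 𝔫 ≠ 0 :=
  finprod_asIdeal_pow_ne_zero (eventually_ord1_sub_ord0_eq_zero 𝔫)

theorem dvd_sqfreePart_iff (𝔫 : Ideal (𝓞 F)) (p : HeightOneSpectrum (𝓞 F)) :
    p.asIdeal ∣ sqfreePart 𝔫 ↔ ord1 𝔫 p = ord0 𝔫 p + 1 := by
  rw [sqfreePart, asIdeal_dvd_finprod_pow_iff (eventually_ord1_sub_ord0_eq_zero 𝔫)]
  unfold ord0 ord1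
  omega

theorem ord1_eq_ord0_of_not_dvd {𝔫 : Ideal (𝓞 F)} {p : HeightOneSpectrum (𝓞 F)}
    (h : ¬ p.asIdeal ∣ sqfreePart 𝔫) : ord1 𝔫 p = ord0 𝔫 p := by
  rw [dvd_sqfreePart_iff] at h
  unfold ord0 ord1 at *
  omega

end SquarefreePart

/-! ### Strong approximation -/

section StableRange

theorem valuation_add_eq_one {K Γ₀ : Type*} [CommRing K] [LinearOrderedCommGroupWithZero Γ₀]
    (v : Valuation K Γ₀) {a b c d : K} (ha : v a ≤ 1) (hb : v b ≤ 1) (hc : v c < 1) (hd : v d ≤ 1)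
    (habcd : a * c + b * d = 1) : v (c + d) = 1 := by
  have hvd : v d = 1 := by
    refine hd.antisymm (not_lt.1 fun hlt => ?_)
    have hlt_one : v (a * c + b * d) < 1 := by
      refine v.map_add_lt ?_ ?_ <;> rw [map_mul]
      · exact mul_lt_one_of_nonneg_of_lt_one_right ha zero_le hc
      · exact mul_lt_one_of_nonneg_of_lt_one_right hb zero_le hlt
    rw [habcd, map_one] at hlt_one
    exact lt_irrefl _ hlt_one
  rw [v.map_add_eq_of_lt_right (by rwa [hvd]), hvd]

variable {R K : Type*} [CommRing R] [IsDedekindDomain R] [Field K] [Algebra R K]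
  [IsFractionRing R K]

theorem exists_isUnit_add_mul_of_isCoprime {c d : FiniteAdeleRing R K} (hcd : IsCoprime c d) :
    ∃ ε, IsUnit (c + d * ε) := by
  classical
  obtain ⟨a, b, hab⟩ := hcd
  have hab_apply (p : HeightOneSpectrum R) : a p * c p + b p * d p = 1 :=
    congrArg (fun x : FiniteAdeleRing R K => x p) hab
  let ε : FiniteAdeleRing R K :=
    ⟨fun p => if Valued.v (c p) = 1 ∨ c p + d p = 0 then 0 else 1,
      Filter.Eventually.of_forall fun p => by
        dsimp only
        split_ifs
        · exact zero_mem _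
        · exact one_mem _⟩
  have hε (p : HeightOneSpectrum R) : (c + d * ε) p
      = c p + d p * if Valued.v (c p) = 1 ∨ c p + d p = 0 then 0 else 1 := rfl
  refine ⟨ε, FiniteAdeleRing.isUnit_iff.2 ⟨fun p => ?_, ?_⟩⟩
  · rw [hε]
    split_ifs with h
    · rw [mul_zero, add_zero]
      rintro hc0
      rcases h with h | h
      · simp [hc0] at h
      · rw [hc0, zero_add] at h
        simpa [hc0, h] using hab_apply p
    · rw [mul_one]
      exact fun h0 => h (Or.inr h0)
  · filter_upwards [a.2, b.2, c.2, d.2] with p ha hb hc hd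
    rw [hε]
    by_cases hc1 : Valued.v (c p) = 1
    · rw [if_pos (Or.inl hc1), mul_zero, add_zero, hc1]
    · have hone : Valued.v (c p + d p) = 1 :=
        valuation_add_eq_one Valued.v ha hb (lt_of_le_of_ne hc hc1) hd (hab_apply p)
      have hne : c p + d p ≠ 0 := fun h0 => by
        rw [h0, map_zero] at hone
        exact zero_ne_one hone
      rw [if_neg (not_or_intro hc1 hne), mul_one, hone]

end StableRange

section Unipotent

variable {R : Type*} [CommRing R]

/-- The lower triangular unipotent matrix `(1 0; x 1)`. -/
def nLower (x : R) : GL (Fin 2) R where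
  val := !![1, 0; x, 1]
  inv := !![1, 0; -x, 1]
  val_inv := by simp [Matrix.one_fin_two]
  inv_val := by simp [Matrix.one_fin_two]

@[simp] theorem val_nLower (x : R) : (nLower x).val = !![1, 0; x, 1] := rfl

theorem nLower_eq_conj_nMat (x : R) : nLower x = weyl * nMat (-x) * weyl⁻¹ := by
  rw [eq_mul_inv_iff_mul_eq]
  apply Units.ext
  simp

theorem nLower_mul_nLower_neg (x : R) : nLower x * nLower (-x) = 1 := by
  apply Units.ext
  simp [Matrix.one_fin_two]

theorem eq_nMat_mul_nLower_mul_nMat {g : GL (Fin 2) R} (hg : g.val.det = 1) {u : Rˣ}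
    (hu : g.val 1 0 = u) :
    g = nMat ((g.val 0 0 - 1) * (u⁻¹ : Rˣ)) * nLower (u : R) *
      nMat ((g.val 1 1 - 1) * (u⁻¹ : Rˣ)) := by
  apply Units.ext
  rw [Matrix.det_fin_two, hu] at hg
  have huu : (u : R) * (u⁻¹ : Rˣ) = 1 := Units.mul_inv u
  rw [Units.val_mul, Units.val_mul, val_nMat, val_nLower, val_nMat, Matrix.mul_fin_two,
    Matrix.mul_fin_two]
  conv_lhs => rw [Matrix.eta_fin_two g.val, hu]
  congrm !![?_, ?_; ?_, ?_]
  · linear_combination (1 - g.val 0 0) * huu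
  · linear_combination (-g.val 0 1 - (g.val 0 0 - 1) * (g.val 1 1 - 1) * (u⁻¹ : Rˣ)) * huu
      - (u⁻¹ : Rˣ) * hg
  · ring
  · linear_combination (1 - g.val 1 1) * huu

end Unipotent

section StrongApproximation

variable {F : Type*} [Field F] [NumberField F]

/-- The diagonal embedding `GL₂(F) → GL₂(𝔸_fin)`. -/
noncomputable def rationalFin : GL (Fin 2) F →* GL (Fin 2) (FinAdele F) :=
  Matrix.GeneralLinearGroup.map (algebraMap F (FinAdele F))

theorem finPart_rational (γ : GL (Fin 2) F) : finPart (rational γ) = rationalFin γ := rfl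

/-- A subgroup of `GL₂(𝔸_fin)` whose intersection with `SL₂(𝔸_fin)` contains the principal
congruence subgroup of level `∏ 𝔭 ^ e_𝔭`, for some `e`. -/
def ContainsCongruence (H : Subgroup (GL (Fin 2) (FinAdele F))) : Prop :=
  ∃ e : HeightOneSpectrum (𝓞 F) → ℕ, (∀ᶠ p in Filter.cofinite, e p = 0) ∧
    ∀ g : GL (Fin 2) (FinAdele F), g.val.det = 1 →
      (∀ p i j, Valued.v (evalFin p ((g.val - 1) i j)) ≤ WithZero.exp (-(e p : ℤ))) → g ∈ H

theorem exists_forall_valued_apply_le (A : Matrix (Fin 2) (Fin 2) (FinAdele F)) :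
    ∃ e : HeightOneSpectrum (𝓞 F) → ℕ, (∀ᶠ p in Filter.cofinite, e p = 0) ∧
      ∀ p i j, Valued.v (evalFin p (A i j)) ≤ WithZero.exp (e p : ℤ) := by
  choose d hd hA using fun ij : Fin 2 × Fin 2 => exists_forall_valued_le (A ij.1 ij.2)
  refine ⟨fun p => ∑ ij, d ij p, ?_, fun p i j => (hA (i, j) p).trans ?_⟩
  · filter_upwards [Filter.eventually_all.2 hd] with p hp
    exact Finset.sum_eq_zero fun ij _ => hp ij
  · rw [WithZero.exp_le_exp, Nat.cast_le]
    exact Finset.single_le_sum (f := fun ij => d ij p) (fun _ _ => Nat.zero_le _)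
      (Finset.mem_univ (i, j))

theorem valued_mul_apply_le {p : HeightOneSpectrum (𝓞 F)}
    {A B : Matrix (Fin 2) (Fin 2) (FinAdele F)} {a b : ℤ}
    (hA : ∀ i j, Valued.v (evalFin p (A i j)) ≤ WithZero.exp a)
    (hB : ∀ i j, Valued.v (evalFin p (B i j)) ≤ WithZero.exp b) (i j : Fin 2) :
    Valued.v (evalFin p ((A * B) i j)) ≤ WithZero.exp (a + b) := by
  rw [Matrix.mul_apply, Fin.sum_univ_two, map_add, map_mul, map_mul, WithZero.exp_add]
  refine Valuation.map_add_le _ ?_ ?_ <;> rw [map_mul] <;> exact mul_le_mul' (hA _ _) (hB _ _)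

theorem ContainsCongruence.comap_conj {H : Subgroup (GL (Fin 2) (FinAdele F))}
    (hH : ContainsCongruence H) (c : GL (Fin 2) (FinAdele F)) :
    ContainsCongruence (H.comap (MulAut.conj c).toMonoidHom) := by
  obtain ⟨e, he, hH⟩ := hH
  obtain ⟨d, hd, hc⟩ := exists_forall_valued_apply_le c.val
  obtain ⟨d', hd', hc'⟩ := exists_forall_valued_apply_le c⁻¹.val
  refine ⟨fun p => e p + d p + d' p, ?_, fun g hdet hg => hH _ ?_ fun p i j => ?_⟩
  · filter_upwards [he, hd, hd'] with p hep hdp hdp'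
    rw [hep, hdp, hdp']
  · change (c.val * g.val * c⁻¹.val).det = 1
    rw [Matrix.det_mul_right_comm, Units.mul_inv, one_mul, hdet]
  · have hsub : ((MulAut.conj c).toMonoidHom g).val - 1 = c.val * (g.val - 1) * c⁻¹.val := by
      change c.val * g.val * c⁻¹.val - 1 = _
      rw [mul_sub, sub_mul, mul_one, Units.mul_inv]
    rw [hsub]
    refine (valued_mul_apply_le (valued_mul_apply_le (hc p) (hg p)) (hc' p) i j).trans ?_
    rw [WithZero.exp_le_exp]
    push_cast
    omega

/-- Elements `g` of `GL₂(𝔸_fin)` that lie in `GL₂(F) H` for every `H` containing a congruence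
subgroup. Strong approximation says that `SL₂(𝔸_fin)` consists of such elements. -/
def IsApproximable (g : GL (Fin 2) (FinAdele F)) : Prop :=
  ∀ H : Subgroup (GL (Fin 2) (FinAdele F)), ContainsCongruence H →
    ∃ γ : GL (Fin 2) F, ∃ h ∈ H, g = rationalFin γ * h

theorem IsApproximable.mul {g₁ g₂ : GL (Fin 2) (FinAdele F)} (h₁ : IsApproximable g₁)
    (h₂ : IsApproximable g₂) : IsApproximable (g₁ * g₂) := by
  intro H hH
  obtain ⟨γ₂, k₂, hk₂, rfl⟩ := h₂ H hH
  obtain ⟨γ₁, k₁, hk₁, rfl⟩ := h₁ _ (hH.comap_conj (rationalFin γ₂)⁻¹)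
  refine ⟨γ₁ * γ₂, _, mul_mem hk₁ hk₂, ?_⟩
  change _ = rationalFin (γ₁ * γ₂) * ((rationalFin γ₂)⁻¹ * k₁ * ((rationalFin γ₂)⁻¹)⁻¹ * k₂)
  rw [map_mul]
  group

theorem isApproximable_rationalFin (γ : GL (Fin 2) F) : IsApproximable (rationalFin γ) :=
  fun H _ => ⟨γ, 1, one_mem H, (mul_one _).symm⟩

theorem isApproximable_nMat (x : FinAdele F) : IsApproximable (nMat x) := by
  rintro H ⟨e, he, hH⟩
  obtain ⟨a, ha⟩ := exists_forall_valued_sub_algebraMap_le x he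
  refine ⟨nMat a, nMat (x - algebraMap F _ a), hH _ (by simp) fun p i j => ?_, ?_⟩
  · have hsub : (nMat (x - algebraMap F (FinAdele F) a)).val - 1
        = !![0, x - algebraMap F (FinAdele F) a; 0, 0] := by
      rw [val_nMat, Matrix.one_fin_two]
      ext i j : 2
      fin_cases i <;> fin_cases j <;> simp
    rw [hsub]
    fin_cases i <;> fin_cases j
    · simp
    · exact ha p
    · simp
    · simp
  · rw [rationalFin, map_nMat, ← nMat_add, add_sub_cancel]

theorem isApproximable_nLower (x : FinAdele F) : IsApproximable (nLower x) := by
  have hweyl : rationalFin (F := F) weyl = weyl := map_weyl _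
  rw [nLower_eq_conj_nMat, ← hweyl, ← map_inv]
  exact ((isApproximable_rationalFin _).mul (isApproximable_nMat _)).mul
    (isApproximable_rationalFin _)

theorem isApproximable_of_det_eq_one {g : GL (Fin 2) (FinAdele F)} (hg : g.val.det = 1) :
    IsApproximable g := by
  have hcoprime : IsCoprime (g.val 1 0) (g.val 1 1) := by
    refine ⟨-g.val 0 1, g.val 0 0, ?_⟩
    rw [Matrix.det_fin_two] at hg
    linear_combination hg
  obtain ⟨ε, u, hu⟩ := exists_isUnit_add_mul_of_isCoprime hcoprime
  have hlowerLeft : (g * nLower ε).val 1 0 = u := by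
    rw [Units.val_mul, val_nLower, Matrix.mul_apply, Fin.sum_univ_two, hu]
    simp
  have hdet : (g * nLower ε).val.det = 1 := by
    rw [Units.val_mul, Matrix.det_mul, hg, val_nLower]
    simp
  rw [← mul_one g, ← nLower_mul_nLower_neg ε, ← mul_assoc,
    eq_nMat_mul_nLower_mul_nMat hdet hlowerLeft]
  exact (((isApproximable_nMat _).mul (isApproximable_nLower _)).mul
    (isApproximable_nMat _)).mul (isApproximable_nLower _)

theorem IsClassRepresentatives.exists_eq_mul_mul
    {θ : Fin (NumberField.classNumber F) → (FinAdele F)ˣ} (hθ : IsClassRepresentatives θ)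
    (δ : (FinAdele F)ˣ) :
    ∃ α : Fˣ, ∃ i, ∃ u : (FinAdele F)ˣ, (∀ p, Valued.v ((u : FinAdele F) p) = 1) ∧
      δ = Units.map (algebraMap F (FinAdele F) : F →* FinAdele F) α * θ i * u := by
  obtain ⟨i, α, hα⟩ := hθ.exists_valued_eq_valued_mul δ
  refine ⟨α, i, (Units.map (algebraMap F (FinAdele F) : F →* FinAdele F) α * θ i)⁻¹ * δ,
    fun p => ?_, by group⟩
  set u := (Units.map (algebraMap F (FinAdele F) : F →* FinAdele F) α * θ i)⁻¹ * δ with hu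
  have hδu : algebraMap F (p.adicCompletion F) α * (θ i : FinAdele F) p * (u : FinAdele F) p
      = (δ : FinAdele F) p :=
    congrArg (fun x : (FinAdele F)ˣ => (x : FinAdele F) p) (eq_inv_mul_iff_mul_eq.1 hu)
  have hδ0 : Valued.v ((δ : FinAdele F) p) ≠ 0 :=
    (Valuation.ne_zero_iff _).2 ((FiniteAdeleRing.isUnit_iff.1 δ.isUnit).1 p)
  have hδp := hα p
  rw [← hδu, map_mul, map_mul] at hδp
  refine (mul_eq_left₀ ?_).1 hδp
  intro h0
  exact hδ0 (by rw [← hδu, map_mul, map_mul, h0, zero_mul])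

theorem IsClassRepresentatives.exists_eq_rationalFin_mul
    {θ : Fin (NumberField.classNumber F) → (FinAdele F)ˣ}
    (hθ : IsClassRepresentatives θ) {H : Subgroup (GL (Fin 2) (FinAdele F))}
    (hH : ContainsCongruence H)
    (hunits : ∀ u : (FinAdele F)ˣ, (∀ p, Valued.v ((u : FinAdele F) p) = 1) → aMat u ∈ H)
    (g : GL (Fin 2) (FinAdele F)) :
    ∃ γ : GL (Fin 2) F, ∃ i, ∃ h ∈ H, g = rationalFin γ * aMat (θ i) * h := by
  obtain ⟨α, i, u, hu, hdet⟩ := hθ.exists_eq_mul_mul (Matrix.GeneralLinearGroup.det g)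
  set α' := Units.map (algebraMap F (FinAdele F) : F →* FinAdele F) α
  have hα' : aMat α' = rationalFin (aMat α) := (map_aMat _ _).symm
  have hdet_aMat (y : (FinAdele F)ˣ) : Matrix.GeneralLinearGroup.det (aMat y) = y := by
    apply Units.ext
    simp
  have hdet_one :
      Matrix.GeneralLinearGroup.det ((aMat α')⁻¹ * g * (aMat u)⁻¹ * (aMat (θ i))⁻¹) = 1 := by
    simp only [map_mul, map_inv, hdet_aMat, hdet]
    rw [mul_assoc α', inv_mul_cancel_left, mul_inv_cancel_right, mul_inv_cancel]
  obtain ⟨γ, h, hh, hγ⟩ := isApproximable_of_det_eq_one (congrArg Units.val hdet_one) _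
    (hH.comap_conj (aMat (θ i))⁻¹)
  refine ⟨aMat α * γ, i, _, mul_mem hh (hunits u hu), ?_⟩
  change g = _ * _ * ((aMat (θ i))⁻¹ * h * ((aMat (θ i))⁻¹)⁻¹ * aMat u)
  calc g = aMat α' * ((aMat α')⁻¹ * g * (aMat u)⁻¹ * (aMat (θ i))⁻¹) *
        aMat (θ i) * aMat u := by group
    _ = _ := by
      rw [hγ, map_mul, ← hα']
      group

end StrongApproximation

/-! ### Special matrices and `K^*` -/

section Iwasawa

theorem norm_sq_add_norm_sq_pos {K : Type*} [NormedField K] (g : GL (Fin 2) K) :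
    0 < ‖g.val 1 0‖ ^ 2 + ‖g.val 1 1‖ ^ 2 := by
  obtain h | h := bottomRow_ne_zero g <;> positivity

theorem exists_eq_bMat_mul_zMat_mul {K : Type*} [Field K] (g : GL (Fin 2) K) {ρ : Kˣ} {c' d' : K}
    (hρ : (ρ : K) ^ 2 = g.val 1 0 * c' + g.val 1 1 * d') :
    ∃ (y : Kˣ) (x : K) (k : GL (Fin 2) K),
      k.val = !![d' / ρ, -c' / ρ; g.val 1 0 / ρ, g.val 1 1 / ρ] ∧
        g = bMat y x * (zMat ρ * k) := by
  have hρ0 : (ρ : K) ≠ 0 := ρ.ne_zero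
  have hdet : g.val 0 0 * g.val 1 1 - g.val 0 1 * g.val 1 0 ≠ 0 := by
    rw [← Matrix.det_fin_two]
    exact g.det_ne_zero
  have hdet_k : (!![d' / (ρ : K), -c' / ρ; g.val 1 0 / ρ, g.val 1 1 / ρ]).det = 1 := by
    rw [Matrix.det_fin_two_of]
    field_simp
    linear_combination -hρ
  let k : GL (Fin 2) K := Matrix.GeneralLinearGroup.mkOfDetNeZero _ (hdet_k ▸ one_ne_zero)
  have hk : k.val = !![d' / (ρ : K), -c' / ρ; g.val 1 0 / ρ, g.val 1 1 / ρ] := rfl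
  refine ⟨Units.mk0 ((g.val 0 0 * g.val 1 1 - g.val 0 1 * g.val 1 0) / (ρ : K) ^ 2)
      (div_ne_zero hdet (pow_ne_zero _ hρ0)), (g.val 0 0 * c' + g.val 0 1 * d') / (ρ : K) ^ 2,
    k, hk, Units.ext ?_⟩
  simp only [Units.val_mul, val_zMat, val_bMat, Units.val_mk0, hk, Matrix.mul_fin_two]
  conv_lhs => rw [Matrix.eta_fin_two g.val]
  congrm !![?_, ?_; ?_, ?_]
  · field_simp
    linear_combination g.val 0 0 * ρ * hρ
  · field_simp
    linear_combination g.val 0 1 * ρ * hρ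
  · field_simp
    ring
  · field_simp
    ring

theorem div_ofReal_mem_unitaryGroup {c d : ℂ} {r : ℝ} (hr : r ≠ 0)
    (hcd : c * star c + d * star d = (r : ℂ) ^ 2) :
    !![star d / r, -star c / r; c / r, d / r] ∈ Matrix.unitaryGroup (Fin 2) ℂ := by
  have hrC : (r : ℂ) ≠ 0 := by exact_mod_cast hr
  have hstar : star !![star d / (r : ℂ), -star c / r; c / r, d / r]
      = !![d / r, star c / r; -c / r, star d / r] := by
    ext i j : 2
    fin_cases i <;> fin_cases j <;> simp [Matrix.star_apply]
  rw [Matrix.mem_unitaryGroup_iff, hstar, Matrix.mul_fin_two, Matrix.one_fin_two]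
  congrm !![?_, ?_; ?_, ?_]
  · field_simp
    linear_combination hcd
  · field_simp
    ring
  · field_simp
    ring
  · field_simp
    linear_combination hcd

end Iwasawa

section Archimedean

variable {F : Type*} [Field F] {v : InfinitePlace F}

open InfinitePlace.Completion

theorem exists_extensionEmbedding_eq_star (c : v.Completion) :
    ∃ c' : v.Completion, extensionEmbedding v c' = star (extensionEmbedding v c) := by
  rcases v.isReal_or_isComplex with hv | hv
  · refine ⟨c, ?_⟩
    rw [← extensionEmbeddingOfIsReal_apply hv]
    exact (Complex.conj_ofReal _).symm
  · exact surjective_extensionEmbedding_of_isComplex hv _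

theorem exists_extensionEmbedding_eq_ofReal (v : InfinitePlace F) (r : ℝ) :
    ∃ c : v.Completion, extensionEmbedding v c = r := by
  rcases v.isReal_or_isComplex with hv | hv
  · obtain ⟨c, hc⟩ := surjective_extensionEmbeddingOfIsReal hv r
    exact ⟨c, by rw [← extensionEmbeddingOfIsReal_apply hv, hc]⟩
  · exact surjective_extensionEmbedding_of_isComplex hv _

theorem norm_extensionEmbedding (c : v.Completion) : ‖extensionEmbedding v c‖ = ‖c‖ := by
  simpa using (isometry_extensionEmbedding v).dist_eq c 0

theorem extensionEmbedding_mul_star (c : v.Completion) :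
    extensionEmbedding v c * star (extensionEmbedding v c) = (‖c‖ : ℂ) ^ 2 := by
  rw [← norm_extensionEmbedding c]
  exact RCLike.mul_conj _

/-- `K_ν` as a subgroup of `GL₂(F_ν)`. -/
noncomputable def KInfSubgroup (v : InfinitePlace F) : Subgroup (GL (Fin 2) v.Completion) where
  carrier := KInf v
  one_mem' := by simp [KInf, one_mem]
  mul_mem' {g h} hg hh := by
    change (g.val * h.val).map (extensionEmbedding v) ∈ Matrix.unitaryGroup (Fin 2) ℂ
    rw [Matrix.map_mul]
    exact mul_mem hg hh
  inv_mem' {g} hg := by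
    have hinv : g.val.map (extensionEmbedding v) * g⁻¹.val.map (extensionEmbedding v) = 1 := by
      rw [← Matrix.map_mul, Units.mul_inv, Matrix.map_one _ (map_zero _) (map_one _)]
    change g⁻¹.val.map (extensionEmbedding v) ∈ Matrix.unitaryGroup (Fin 2) ℂ
    rw [← left_inv_eq_right_inv (Matrix.mem_unitaryGroup_iff'.1 hg) hinv]
    exact Unitary.star_mem hg

theorem exists_bMat_inv_mul_mem_centerMul_KInfSubgroup (g : GL (Fin 2) v.Completion) :
    ∃ (y : v.Completionˣ) (x : v.Completion), (bMat y x)⁻¹ * g ∈ centerMul (KInfSubgroup v) := by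
  obtain ⟨c', hc'⟩ := exists_extensionEmbedding_eq_star (g.val 1 0)
  obtain ⟨d', hd'⟩ := exists_extensionEmbedding_eq_star (g.val 1 1)
  have hpos := norm_sq_add_norm_sq_pos g
  set r := Real.sqrt (‖g.val 1 0‖ ^ 2 + ‖g.val 1 1‖ ^ 2) with hr
  have hr0 : r ≠ 0 := (Real.sqrt_pos.2 hpos).ne'
  have hsum : extensionEmbedding v (g.val 1 0) * star (extensionEmbedding v (g.val 1 0))
      + extensionEmbedding v (g.val 1 1) * star (extensionEmbedding v (g.val 1 1))
      = (r : ℂ) ^ 2 := by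
    rw [extensionEmbedding_mul_star, extensionEmbedding_mul_star, ← Complex.ofReal_pow r, hr,
      Real.sq_sqrt hpos.le]
    push_cast
    rfl
  obtain ⟨ρ, hρ⟩ := exists_extensionEmbedding_eq_ofReal v r
  have hρ0 : ρ ≠ 0 := by
    rintro rfl
    rw [map_zero] at hρ
    exact hr0 (by exact_mod_cast hρ.symm)
  have hρ_sq : ρ ^ 2 = g.val 1 0 * c' + g.val 1 1 * d' := by
    apply (extensionEmbedding v).injective
    rw [map_pow, map_add, map_mul, map_mul, hc', hd', hρ, hsum]
  obtain ⟨y, x, k, hk, hg⟩ := exists_eq_bMat_mul_zMat_mul g (ρ := Units.mk0 ρ hρ0) hρ_sq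
  refine ⟨y, x, Units.mk0 ρ hρ0, k, ?_, inv_mul_eq_iff_eq_mul.2 hg⟩
  have hmap : k.val.map (extensionEmbedding v) =
      !![star (extensionEmbedding v (g.val 1 1)) / (r : ℂ),
        -star (extensionEmbedding v (g.val 1 0)) / r;
        extensionEmbedding v (g.val 1 0) / r, extensionEmbedding v (g.val 1 1) / r] := by
    rw [hk]
    ext i j : 2
    fin_cases i <;> fin_cases j <;> simp [hc', hd', hρ]
  change k.val.map (extensionEmbedding v) ∈ Matrix.unitaryGroup (Fin 2) ℂ
  rw [hmap]
  exact div_ofReal_mem_unitaryGroup hr0 hsum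

end Archimedean

section KStar

variable {F : Type*} [Field F] [NumberField F]

theorem compFin_mem_KFin_of_valued_sub_one_le {p : HeightOneSpectrum (𝓞 F)}
    {g : GL (Fin 2) (FinAdele F)} (hdet : g.val.det = 1)
    (hg : ∀ i j, Valued.v (evalFin p ((g.val - 1) i j)) ≤ 1) : compFin p g ∈ KFin p := by
  refine mem_KFin_iff.2 ⟨fun i j => ?_, ?_⟩
  · have hentry : (compFin p g).val i j = evalFin p ((g.val - 1) i j)
        + evalFin p ((1 : Matrix (Fin 2) (Fin 2) (FinAdele F)) i j) := by
      rw [← map_add, ← Matrix.add_apply, sub_add_cancel]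
      rfl
    rw [hentry]
    refine Valuation.map_add_le _ (hg i j) ?_
    fin_cases i <;> fin_cases j <;> simp
  · have hdet_map : (compFin p g).val.det = evalFin p g.val.det := (RingHom.map_det _ _).symm
    rw [hdet_map, hdet, map_one, map_one]

open Classical in
/-- The local component of `K^*` at a finite place. -/
noncomputable def localStar (ϖ : Uniformizers F) (𝔞 : Ideal (𝓞 F)) (p : HeightOneSpectrum (𝓞 F)) :
    Subgroup (GL (Fin 2) (p.adicCompletion F)) :=
  if p.asIdeal ∣ 𝔞 then Subgroup.closure (K0Fin p 1 ∪ {antiMat (ϖ.unit p)})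
  else centerMul (KFin p)

/-- The finite part of `K^*`. -/
noncomputable def finStar (ϖ : Uniformizers F) (𝔞 : Ideal (𝓞 F)) :
    Subgroup (GL (Fin 2) (FinAdele F)) :=
  ⨅ p, (localStar ϖ 𝔞 p).comap (compFin p)

/-- `K^*` as a subgroup of `GL₂(𝔸_F)`. -/
noncomputable def KStarSubgroup (ϖ : Uniformizers F) (𝔞 : Ideal (𝓞 F)) :
    Subgroup (GL (Fin 2) (Adele F)) :=
  (⨅ v, (centerMul (KInfSubgroup v)).comap (compInf v)) ⊓ (finStar ϖ 𝔞).comap finPart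

variable (ϖ : Uniformizers F) (𝔞 : Ideal (𝓞 F))

theorem mem_finStar {g : GL (Fin 2) (FinAdele F)} :
    g ∈ finStar ϖ 𝔞 ↔ ∀ p, compFin p g ∈ localStar ϖ 𝔞 p := by
  simp only [finStar, Subgroup.mem_iInf, Subgroup.mem_comap]

theorem mem_KStarSubgroup {g : GL (Fin 2) (Adele F)} : g ∈ KStarSubgroup ϖ 𝔞 ↔
    (∀ v, compInf v g ∈ centerMul (KInfSubgroup v)) ∧
      ∀ p, compFin p (finPart g) ∈ localStar ϖ 𝔞 p := by
  simp only [KStarSubgroup, Subgroup.mem_inf, Subgroup.mem_iInf, Subgroup.mem_comap, mem_finStar]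

theorem mem_KStar_iff_mem_KStarSubgroup {g : GL (Fin 2) (Adele F)} :
    g ∈ KStar ϖ 𝔞 ↔ g ∈ KStarSubgroup ϖ 𝔞 := by
  rw [mem_KStarSubgroup]
  refine and_congr Iff.rfl ⟨fun h p => ?_, fun h => ⟨fun p hp => ?_, fun p hp => ?_⟩⟩
  · unfold localStar
    split_ifs with hp
    · exact h.2 p hp
    · exact h.1 p hp
  · rw [← mem_centerMul]
    simpa only [localStar, if_neg hp] using h p
  · simpa only [localStar, if_pos hp] using h p

theorem mem_localStar_of_mem_K0Fin {p : HeightOneSpectrum (𝓞 F)}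
    {g : GL (Fin 2) (p.adicCompletion F)} (hg : g ∈ K0Fin p 1) : g ∈ localStar ϖ 𝔞 p := by
  unfold localStar
  split_ifs
  · exact Subgroup.subset_closure (Or.inl hg)
  · exact le_centerMul _ hg.1

theorem containsCongruence_finStar {𝔞 : Ideal (𝓞 F)} (h𝔞 : 𝔞 ≠ 0) :
    ContainsCongruence (finStar ϖ 𝔞) := by
  classical
  refine ⟨fun p => if p.asIdeal ∣ 𝔞 then 1 else 0, ?_, fun g hdet hg => ?_⟩
  · filter_upwards [(Ideal.finite_factors h𝔞).compl_mem_cofinite] with p hp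
    exact if_neg hp
  · rw [mem_finStar]
    intro p
    have hK : compFin p g ∈ KFin p := by
      refine compFin_mem_KFin_of_valued_sub_one_le hdet fun i j => (hg p i j).trans ?_
      rw [← WithZero.exp_zero, WithZero.exp_le_exp]
      omega
    by_cases hp : p.asIdeal ∣ 𝔞
    · refine mem_localStar_of_mem_K0Fin ϖ 𝔞 ⟨hK, ?_⟩
      simpa [hp, compFin] using hg p 1 0
    · rw [localStar, if_neg hp]
      exact le_centerMul _ hK

theorem aMat_mem_finStar (u : (FinAdele F)ˣ) (hu : ∀ p, Valued.v ((u : FinAdele F) p) = 1) :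
    aMat u ∈ finStar ϖ 𝔞 := by
  rw [mem_finStar]
  intro p
  have hup : Valued.v (evalFin p (u : FinAdele F)) = 1 := hu p
  rw [compFin, map_aMat]
  refine mem_localStar_of_mem_K0Fin ϖ 𝔞 ⟨mem_KFin_iff.2 ⟨fun i j => ?_, ?_⟩, ?_⟩
  · fin_cases i <;> fin_cases j <;> simp [hup]
  · simpa using hup
  · simp

end KStar

section Components

variable {F : Type*} [Field F]

/-- The projection of `F_∞` to `F_ν`. -/
noncomputable def evalArch (v : InfinitePlace F) : InfiniteAdeleRing F →+* v.Completion :=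
  Pi.evalRingHom _ v

/-- The element of `F_∞ˣ` with given components. -/
noncomputable def archUnit (y : ∀ v : InfinitePlace F, v.Completionˣ) : (InfiniteAdeleRing F)ˣ :=
  MulEquiv.piUnits.symm y

theorem map_evalArch_archUnit (y : ∀ v : InfinitePlace F, v.Completionˣ) (v : InfinitePlace F) :
    Units.map (evalArch v : InfiniteAdeleRing F →* v.Completion) (archUnit y) = y v :=
  Units.ext rfl

variable [NumberField F]

theorem compInf_glPair (v : InfinitePlace F) (b : GL (Fin 2) (InfiniteAdeleRing F))
    (g : GL (Fin 2) (FinAdele F)) :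
    compInf v (glPair b g) = Matrix.GeneralLinearGroup.map (evalArch v) b := rfl

theorem finPart_glPair (b : GL (Fin 2) (InfiniteAdeleRing F)) (g : GL (Fin 2) (FinAdele F)) :
    finPart (glPair b g) = g := rfl

theorem compInf_special (θ : Fin (NumberField.classNumber F) → (FinAdele F)ˣ)
    (y : (InfiniteAdeleRing F)ˣ) (x : InfiniteAdeleRing F) (i : Fin (NumberField.classNumber F))
    (v : InfinitePlace F) : compInf v (special θ y x i) =
      bMat (Units.map (evalArch v : InfiniteAdeleRing F →* v.Completion) y) (x v) := by
  rw [special, compInf_glPair, map_bMat]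
  rfl

theorem finPart_special (θ : Fin (NumberField.classNumber F) → (FinAdele F)ˣ)
    (y : (InfiniteAdeleRing F)ˣ) (x : InfiniteAdeleRing F) (i : Fin (NumberField.classNumber F)) :
    finPart (special θ y x i) = aMat (θ i) := rfl

theorem exists_eq_rational_mul_special_mul (ϖ : Uniformizers F)
    {θ : Fin (NumberField.classNumber F) → (FinAdele F)ˣ} (hθ : IsClassRepresentatives θ)
    {𝔞 : Ideal (𝓞 F)} (h𝔞 : 𝔞 ≠ 0) (g : GL (Fin 2) (Adele F)) :
    ∃ γ y x i, ∃ k ∈ KStar ϖ 𝔞, g = rational γ * special θ y x i * k := by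
  obtain ⟨γ, i, h, hh, hg⟩ := hθ.exists_eq_rationalFin_mul (containsCongruence_finStar ϖ h𝔞)
    (aMat_mem_finStar ϖ 𝔞) (finPart g)
  choose y x hyx using fun v =>
    exists_bMat_inv_mul_mem_centerMul_KInfSubgroup (compInf v ((rational γ)⁻¹ * g))
  obtain ⟨x', hx'⟩ : ∃ x' : InfiniteAdeleRing F, ∀ v, x' v = x v := ⟨x, fun _ => rfl⟩
  refine ⟨γ, archUnit y, x', i, (special θ (archUnit y) x' i)⁻¹ * ((rational γ)⁻¹ * g), ?_,
    by group⟩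
  rw [mem_KStar_iff_mem_KStarSubgroup, mem_KStarSubgroup, ← mem_finStar]
  refine ⟨fun v => ?_, ?_⟩
  · rw [map_mul, map_inv, compInf_special, map_evalArch_archUnit, hx']
    exact hyx v
  · rw [map_mul, map_inv, finPart_special, map_mul, map_inv, finPart_rational, hg]
    convert hh using 1
    group

end Components

/-! ### Heights of bottom rows -/

section BottomRow

variable {R : Type*} [CommRing R]

theorem zMat_mul_apply (z : Rˣ) (g : GL (Fin 2) R) (i j : Fin 2) :
    (zMat z * g).val i j = z * g.val i j := by
  rw [Units.val_mul, val_zMat, Matrix.mul_apply, Fin.sum_univ_two]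
  fin_cases i <;> simp

theorem det_zMat_mul (z : Rˣ) (g : GL (Fin 2) R) :
    (zMat z * g).val.det = (z : R) ^ 2 * g.val.det := by
  rw [Units.val_mul, val_zMat, Matrix.det_mul, Matrix.det_fin_two_of]
  ring

theorem bMat_mul_apply_one (y : Rˣ) (x : R) (g : GL (Fin 2) R) (j : Fin 2) :
    (bMat y x * g).val 1 j = g.val 1 j := by
  rw [Units.val_mul, val_bMat, Matrix.mul_apply, Fin.sum_univ_two]
  simp

theorem det_bMat_mul (y : Rˣ) (x : R) (g : GL (Fin 2) R) :
    (bMat y x * g).val.det = y * g.val.det := by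
  rw [Units.val_mul, val_bMat, Matrix.det_mul, Matrix.det_fin_two_of]
  ring

theorem mul_bMat_apply_one_zero (g : GL (Fin 2) R) (y : Rˣ) (x : R) :
    (g * bMat y x).val 1 0 = g.val 1 0 * y := by
  simp [Matrix.mul_apply, Fin.sum_univ_two]

theorem mul_bMat_apply_one_one (g : GL (Fin 2) R) (y : Rˣ) (x : R) :
    (g * bMat y x).val 1 1 = g.val 1 0 * x + g.val 1 1 := by
  simp [Matrix.mul_apply, Fin.sum_univ_two]

theorem det_mul_bMat (g : GL (Fin 2) R) (y : Rˣ) (x : R) :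
    (g * bMat y x).val.det = g.val.det * y := by
  rw [Units.val_mul, val_bMat, Matrix.det_mul, Matrix.det_fin_two_of]
  ring

theorem bMat_zero (y : Rˣ) : bMat y 0 = aMat y := by
  ext i j
  fin_cases i <;> fin_cases j <;> simp

theorem norm_det_mul_norm_eq {F K : Type*} [Field F] [NormedField K] (f : F →+* K)
    {N : K → K → ℝ} (hN : ∀ a b c, N (a * b) (a * c) = ‖a‖ ^ 2 * N b c)
    {γ : GL (Fin 2) F} {y y' : Kˣ} {x x' : K} {k : GL (Fin 2) K} {e : ℝ}
    (hk : ‖k.val.det‖ = N (k.val 1 0) (k.val 1 1) * e)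
    (h : Matrix.GeneralLinearGroup.map f γ * bMat y x = bMat y' x' * k) {c r s : F} (hc : c ≠ 0)
    (hr : γ.val 1 0 = c * r) (hs : γ.val 1 1 = c * s) :
    ‖f (γ.val.det / c ^ 2)‖ * ‖(y : K)‖ = ‖(y' : K)‖ * N (f r * y) (f r * x + f s) * e := by
  have hc' : ‖f c‖ ≠ 0 := norm_ne_zero_iff.2 ((map_ne_zero f).2 hc)
  have hrow₀ : k.val 1 0 = f c * (f r * y) := by
    rw [← bMat_mul_apply_one y' x', ← h, mul_bMat_apply_one_zero,
      Matrix.GeneralLinearGroup.map_apply, hr, map_mul, mul_assoc]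
  have hrow₁ : k.val 1 1 = f c * (f r * x + f s) := by
    rw [← bMat_mul_apply_one y' x', ← h, mul_bMat_apply_one_one,
      Matrix.GeneralLinearGroup.map_apply, Matrix.GeneralLinearGroup.map_apply, hr, hs, map_mul,
      map_mul]
    ring
  have hdet : f γ.val.det * y = y' * k.val.det := by
    rw [← det_bMat_mul y' x', ← h, det_mul_bMat, RingHom.map_det]
    rfl
  calc ‖f (γ.val.det / c ^ 2)‖ * ‖(y : K)‖
      = ‖f γ.val.det * y‖ / ‖f c‖ ^ 2 := by
        rw [map_div₀, map_pow, norm_div, norm_pow, norm_mul, div_mul_eq_mul_div]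
    _ = ‖(y' : K)‖ * N (f r * y) (f r * x + f s) * e := by
        rw [hdet, norm_mul, hk, hrow₀, hrow₁, hN]
        field_simp

end BottomRow

section FiniteHeights

variable {F : Type*} [Field F] [NumberField F] {p : HeightOneSpectrum (𝓞 F)}

theorem norm_eq_one_of_valued_eq_one {x : p.adicCompletion F} (hx : Valued.v x = 1) : ‖x‖ = 1 :=
  le_antisymm (Valued.toNormedField.norm_le_one_iff.2 hx.le)
    (Valued.toNormedField.one_le_norm_iff.2 hx.ge)

theorem norm_det_of_mem_KFin {u : GL (Fin 2) (p.adicCompletion F)} (hu : u ∈ KFin p) :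
    ‖u.val.det‖ = 1 :=
  norm_eq_one_of_valued_eq_one (mem_KFin_iff.1 hu).2

theorem max_norm_row_of_mem_KFin {u : GL (Fin 2) (p.adicCompletion F)} (hu : u ∈ KFin p) :
    max ‖u.val 1 0‖ ‖u.val 1 1‖ = 1 := by
  have hentry (i j) : ‖u.val i j‖ ≤ 1 :=
    Valued.toNormedField.norm_le_one_iff.2 ((mem_KFin_iff.1 hu).1 i j)
  refine le_antisymm (max_le (hentry _ _) (hentry _ _)) ?_
  by_contra! hrow
  rw [max_lt_iff] at hrow
  have hlt (a b : p.adicCompletion F) (ha : ‖a‖ ≤ 1) (hb : ‖b‖ < 1) : Valued.v (a * b) < 1 := by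
    rw [← Valued.toNormedField.norm_lt_one_iff, norm_mul]
    exact mul_lt_one_of_nonneg_of_lt_one_right ha (norm_nonneg _) hb
  refine (mem_KFin_iff.1 hu).2.not_lt ?_
  rw [Matrix.det_fin_two]
  exact (Valuation.map_sub _ _ _).trans_lt
    (max_lt (hlt _ _ (hentry _ _) hrow.2) (hlt _ _ (hentry _ _) hrow.1))

theorem norm_det_of_mem_centerMul_KFin {k : GL (Fin 2) (p.adicCompletion F)}
    (hk : k ∈ centerMul (KFin p)) : ‖k.val.det‖ = max ‖k.val 1 0‖ ‖k.val 1 1‖ ^ 2 := by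
  obtain ⟨z, u, hu, rfl⟩ := hk
  rw [zMat_mul_apply, zMat_mul_apply, det_zMat_mul, norm_mul, norm_mul, norm_mul, norm_pow,
    ← mul_max_of_nonneg _ _ (norm_nonneg _), norm_det_of_mem_KFin hu, max_norm_row_of_mem_KFin hu,
    mul_one, mul_one]

variable (ϖ : Uniformizers F) {𝔞 : Ideal (𝓞 F)}

theorem norm_det_of_mul_antiMat_mem {k : GL (Fin 2) (p.adicCompletion F)}
    (hk : k * antiMat (ϖ.unit p) ∈ centerMul (K0Subgroup p 1)) :
    ‖k.val.det‖ = max ‖k.val 1 0‖ ‖k.val 1 1‖ ^ 2 * ‖(ϖ.unit p : p.adicCompletion F)‖⁻¹ := by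
  obtain ⟨z, u, hu, hku⟩ := hk
  have hϖ : 0 < ‖(ϖ.unit p : p.adicCompletion F)‖ := norm_pos_iff.2 (ϖ.unit p).ne_zero
  have hdiag : ‖u.val 1 1‖ = 1 :=
    norm_eq_one_of_valued_eq_one (valued_diag_of_mem_K0Fin le_rfl hu).2
  have hlower : ‖u.val 1 0‖ ≤ ‖(ϖ.unit p : p.adicCompletion F)‖ := by
    rw [Valued.toNormedField.norm_le_iff, valued_unit]
    exact hu.2
  have hrow₀ : ‖k.val 1 0‖ = ‖(z : p.adicCompletion F)‖ := by
    have h : (k * antiMat (ϖ.unit p)).val 1 1 = k.val 1 0 := by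
      rw [Units.val_mul, Matrix.mul_apply, Fin.sum_univ_two]
      simp
    rw [← h, hku, zMat_mul_apply, norm_mul, hdiag, mul_one]
  have hrow₁ : ‖k.val 1 1‖ ≤ ‖(z : p.adicCompletion F)‖ := by
    have h : (k * antiMat (ϖ.unit p)).val 1 0 = k.val 1 1 * ϖ.unit p := by
      rw [Units.val_mul, Matrix.mul_apply, Fin.sum_univ_two]
      simp
    refine le_of_mul_le_mul_right ?_ hϖ
    rw [← norm_mul, ← h, hku, zMat_mul_apply, norm_mul]
    gcongr
  have hdet : ‖k.val.det‖ * ‖(ϖ.unit p : p.adicCompletion F)‖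
      = ‖(z : p.adicCompletion F)‖ ^ 2 := by
    have h : (k * antiMat (ϖ.unit p)).val.det = -(k.val.det * ϖ.unit p) := by
      rw [Units.val_mul, Matrix.det_mul, val_antiMat, Matrix.det_fin_two_of]
      ring
    rw [← norm_mul, ← norm_neg, ← h, hku, det_zMat_mul, norm_mul, norm_pow,
      norm_det_of_mem_KFin hu.1, mul_one]
  rw [hrow₀, max_eq_left hrow₁, ← hdet, mul_inv_cancel_right₀ hϖ.ne']

theorem norm_det_of_mem_localStar {k : GL (Fin 2) (p.adicCompletion F)}
    (hk : k ∈ localStar ϖ 𝔞 p) :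
    ‖k.val.det‖ = max ‖k.val 1 0‖ ‖k.val 1 1‖ ^ 2 ∨
      p.asIdeal ∣ 𝔞 ∧ ‖k.val.det‖ =
        max ‖k.val 1 0‖ ‖k.val 1 1‖ ^ 2 * ‖(ϖ.unit p : p.adicCompletion F)‖⁻¹ := by
  unfold localStar at hk
  split_ifs at hk with hp
  · refine (mem_or_mul_antiMat_mem_centerMul ϖ hk).imp ?_
      fun h => ⟨hp, norm_det_of_mul_antiMat_mem ϖ h⟩
    rintro ⟨z, u, hu, rfl⟩
    exact norm_det_of_mem_centerMul_KFin ⟨z, u, hu.1, rfl⟩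
  · exact Or.inl (norm_det_of_mem_centerMul_KFin hk)

theorem exists_forall_norm_det_eq_of_mem_finStar {k : GL (Fin 2) (FinAdele F)}
    (hk : k ∈ finStar ϖ 𝔞) : ∃ S ⊆ {p : HeightOneSpectrum (𝓞 F) | p.asIdeal ∣ 𝔞}, ∀ p,
      ‖(compFin p k).val.det‖ = max ‖(compFin p k).val 1 0‖ ‖(compFin p k).val 1 1‖ ^ 2 *
        S.mulIndicator (fun p => ‖(ϖ.unit p : p.adicCompletion F)‖⁻¹) p := by
  refine ⟨{p | p.asIdeal ∣ 𝔞 ∧ ‖(compFin p k).val.det‖ =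
    max ‖(compFin p k).val 1 0‖ ‖(compFin p k).val 1 1‖ ^ 2 *
      ‖(ϖ.unit p : p.adicCompletion F)‖⁻¹}, fun p hp => hp.1, fun p => ?_⟩
  classical
  rw [Set.mulIndicator_apply]
  split_ifs with hp
  · exact hp.2
  · rw [mul_one]
    exact (norm_det_of_mem_localStar ϖ ((mem_finStar ϖ 𝔞).1 hk p)).resolve_right hp

end FiniteHeights

section ArchimedeanHeights

variable {F : Type*} [Field F] {v : InfinitePlace F}

open InfinitePlace.Completion

theorem norm_det_of_mem_KInf {u : GL (Fin 2) v.Completion} (hu : u ∈ KInf v) :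
    ‖u.val.det‖ = 1 := by
  rw [← norm_extensionEmbedding, RingHom.map_det]
  exact CStarRing.norm_of_mem_unitary (Matrix.det_of_mem_unitary hu)

theorem norm_sq_row_of_mem_KInf {u : GL (Fin 2) v.Completion} (hu : u ∈ KInf v) :
    ‖u.val 1 0‖ ^ 2 + ‖u.val 1 1‖ ^ 2 = 1 := by
  have hrow := congrFun (congrFun (Matrix.mem_unitaryGroup_iff.1 hu) 1) 1
  rw [Matrix.mul_apply, Fin.sum_univ_two, Matrix.star_apply, Matrix.star_apply, Matrix.map_apply,
    Matrix.map_apply, extensionEmbedding_mul_star, extensionEmbedding_mul_star,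
    Matrix.one_apply_eq] at hrow
  exact_mod_cast hrow

theorem norm_det_of_mem_centerMul_KInfSubgroup {k : GL (Fin 2) v.Completion}
    (hk : k ∈ centerMul (KInfSubgroup v)) :
    ‖k.val.det‖ = ‖k.val 1 0‖ ^ 2 + ‖k.val 1 1‖ ^ 2 := by
  obtain ⟨z, u, hu, rfl⟩ := hk
  rw [zMat_mul_apply, zMat_mul_apply, det_zMat_mul, norm_mul, norm_mul, norm_mul, norm_pow,
    mul_pow, mul_pow, ← mul_add, norm_det_of_mem_KInf hu, norm_sq_row_of_mem_KInf hu]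

end ArchimedeanHeights

section RowHeights

variable {F : Type*} [Field F]

theorem norm_algebraMap_completion (v : InfinitePlace F) (a : F) :
    ‖algebraMap F v.Completion a‖ = v a :=
  InfinitePlace.Completion.norm_coe v _

variable [NumberField F]

theorem hasFiniteMulSupport_norm_algebraMap {a : F} (ha : a ≠ 0) :
    (fun p : HeightOneSpectrum (𝓞 F) =>
      ‖algebraMap F (p.adicCompletion F) a‖).HasFiniteMulSupport :=
  (FinitePlace.hasFiniteMulSupport ha).comp_of_injective
    (FinitePlace.equivHeightOneSpectrum (K := F)).symm.injective

theorem prod_norm_algebraMap_mul_finprod_eq_one {a : F} (ha : a ≠ 0) :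
    (∏ v : InfinitePlace F, ‖algebraMap F v.Completion a‖ ^ v.mult) *
      ∏ᶠ p : HeightOneSpectrum (𝓞 F), ‖algebraMap F (p.adicCompletion F) a‖ = 1 := by
  rw [← prod_abs_eq_one ha]
  congr 1
  · simp only [norm_algebraMap_completion]
  · exact finprod_comp_equiv (f := fun w : FinitePlace F => w a)
      (FinitePlace.equivHeightOneSpectrum (K := F)).symm

theorem mulHeight₁_eq_prod_mul_finprod (a : F) : Height.mulHeight₁ a =
    (∏ v : InfinitePlace F, max ‖algebraMap F v.Completion a‖ 1 ^ v.mult) *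
      ∏ᶠ p : HeightOneSpectrum (𝓞 F), max ‖algebraMap F (p.adicCompletion F) a‖ 1 := by
  rw [NumberField.mulHeight₁_eq]
  congr 1
  · simp only [norm_algebraMap_completion]
  · exact (finprod_comp_equiv (f := fun w : FinitePlace F => max (w a) 1)
      (FinitePlace.equivHeightOneSpectrum (K := F)).symm).symm

theorem idele_apply_ne_zero (t : (FinAdele F)ˣ) (p : HeightOneSpectrum (𝓞 F)) :
    (t : FinAdele F) p ≠ 0 :=
  (t.isUnit.map (evalFin p)).ne_zero

theorem hasFiniteMulSupport_norm_idele (t : (FinAdele F)ˣ) :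
    (fun p : HeightOneSpectrum (𝓞 F) => ‖(t : FinAdele F) p‖).HasFiniteMulSupport := by
  have hunit := FiniteAdeleRing.unitsEquiv_finite_valued_eq_one t
  rw [Filter.eventually_cofinite] at hunit
  exact hunit.subset fun p hp hval => hp (norm_eq_one_of_valued_eq_one hval)

theorem infiniteAdele_norm_pos (y : (InfiniteAdeleRing F)ˣ) :
    0 < ‖(y : InfiniteAdeleRing F)‖ := by
  rw [InfiniteAdeleRing.norm_def]
  exact Finset.prod_pos fun v _ =>
    pow_pos (norm_pos_iff.2 ((y.isUnit.map (evalArch v)).ne_zero)) _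

/-- The modulus `∏_𝔭 |t_𝔭|` of a finite idele. -/
noncomputable def finModulus (t : (FinAdele F)ˣ) : ℝ :=
  ∏ᶠ p : HeightOneSpectrum (𝓞 F), ‖(t : FinAdele F) p‖

theorem finModulus_pos (t : (FinAdele F)ˣ) : 0 < finModulus t :=
  finprod_induction (0 < ·) one_pos (fun _ _ => mul_pos)
    fun p => norm_pos_iff.2 (idele_apply_ne_zero t p)

/-- The archimedean part of the height of the row `(r, s) (y x; 0 1)`. -/
noncomputable def archHeight (y : (InfiniteAdeleRing F)ˣ) (x : InfiniteAdeleRing F)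
    (r s : F) : ℝ :=
  ∏ v : InfinitePlace F,
    (‖algebraMap F v.Completion r * (y : InfiniteAdeleRing F) v‖ ^ 2 +
      ‖algebraMap F v.Completion r * x v + algebraMap F v.Completion s‖ ^ 2) ^ v.mult

/-- The finite part of the height of the row `(r, s) a(t)`. -/
noncomputable def finHeight (t : (FinAdele F)ˣ) (r s : F) : ℝ :=
  ∏ᶠ p : HeightOneSpectrum (𝓞 F),
    max ‖algebraMap F (p.adicCompletion F) r * (t : FinAdele F) p‖
      ‖algebraMap F (p.adicCompletion F) s‖ ^ 2

/-- The height of the row `(r, s) g` for `g = (y x; 0 1) a(t)`, with the squared Euclidean norm at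
the archimedean places and the squared maximum norm at the finite ones. -/
noncomputable def rowHeight (y : (InfiniteAdeleRing F)ˣ) (x : InfiniteAdeleRing F)
    (t : (FinAdele F)ˣ) (r s : F) : ℝ :=
  archHeight y x r s * finHeight t r s

theorem archHeight_nonneg (y : (InfiniteAdeleRing F)ˣ) (x : InfiniteAdeleRing F) (r s : F) :
    0 ≤ archHeight y x r s :=
  Finset.prod_nonneg fun _ _ => by positivity

theorem rowHeight_nonneg (y : (InfiniteAdeleRing F)ˣ) (x : InfiniteAdeleRing F)
    (t : (FinAdele F)ˣ) (r s : F) : 0 ≤ rowHeight y x t r s :=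
  mul_nonneg (archHeight_nonneg y x r s) (finprod_nonneg fun _ => by positivity)

/-- The factor by which the elements of `K^*` change heights, where `S` is the set of the places
`𝔭 ∣ 𝔫₂` at which an element lies in the nontrivial coset of `Z K_{0,𝔭}(1)`. -/
noncomputable def levelFactor (ϖ : Uniformizers F) (S : Set (HeightOneSpectrum (𝓞 F))) : ℝ :=
  ∏ᶠ p ∈ S, ‖(ϖ.unit p : p.adicCompletion F)‖⁻¹

theorem one_le_levelFactor (ϖ : Uniformizers F) (S : Set (HeightOneSpectrum (𝓞 F))) :
    1 ≤ levelFactor ϖ S := by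
  refine one_le_finprod fun p => one_le_finprod fun _ =>
    (one_le_inv₀ (norm_pos_iff.2 (ϖ.unit p).ne_zero)).2
      (Valued.toNormedField.norm_le_one_iff.2 ?_)
  rw [valued_unit, ← WithZero.exp_zero, WithZero.exp_le_exp]
  omega

theorem hasFiniteMulSupport_max_norm (t : (FinAdele F)ˣ) {r s : F} (hrs : r ≠ 0 ∨ s ≠ 0) :
    (fun p : HeightOneSpectrum (𝓞 F) =>
      max ‖algebraMap F (p.adicCompletion F) r * (t : FinAdele F) p‖
        ‖algebraMap F (p.adicCompletion F) s‖).HasFiniteMulSupport := by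
  have hrt (hr : r ≠ 0) : (fun p : HeightOneSpectrum (𝓞 F) =>
      ‖algebraMap F (p.adicCompletion F) r * (t : FinAdele F) p‖).HasFiniteMulSupport := by
    simpa only [norm_mul] using
      (hasFiniteMulSupport_norm_algebraMap hr).fun_mul (hasFiniteMulSupport_norm_idele t)
  obtain rfl | hr := eq_or_ne r 0
  · simpa using hasFiniteMulSupport_norm_algebraMap (hrs.resolve_left (· rfl))
  obtain rfl | hs := eq_or_ne s 0
  · simpa only [map_zero, norm_zero, max_eq_left (norm_nonneg _)] using hrt hr
  · exact (hrt hr).max (hasFiniteMulSupport_norm_algebraMap hs)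

end RowHeights

/-! ### The maximum of `|y|` in a double coset -/

section Maximum

variable {F : Type*} [Field F] [NumberField F] (ϖ : Uniformizers F)
  {θ : Fin (NumberField.classNumber F) → (FinAdele F)ˣ} {𝔞 : Ideal (𝓞 F)}

theorem finprod_norm_mul_finModulus_eq (h𝔞 : 𝔞 ≠ 0) {γ : GL (Fin 2) F} {t t' : (FinAdele F)ˣ}
    {k : GL (Fin 2) (FinAdele F)} (hk : k ∈ finStar ϖ 𝔞)
    (h : rationalFin γ * aMat t = aMat t' * k) {c r s : F} (hc : c ≠ 0)
    (hr : γ.val 1 0 = c * r) (hs : γ.val 1 1 = c * s) :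
    ∃ S ⊆ {p : HeightOneSpectrum (𝓞 F) | p.asIdeal ∣ 𝔞},
      (∏ᶠ p : HeightOneSpectrum (𝓞 F), ‖algebraMap F (p.adicCompletion F) (γ.val.det / c ^ 2)‖) *
        finModulus t = finModulus t' * finHeight t r s * levelFactor ϖ S := by
  obtain ⟨S, hS, hdet⟩ := exists_forall_norm_det_eq_of_mem_finStar ϖ hk
  refine ⟨S, hS, ?_⟩
  have hlocal (p : HeightOneSpectrum (𝓞 F)) :
      ‖algebraMap F (p.adicCompletion F) (γ.val.det / c ^ 2)‖ * ‖(t : FinAdele F) p‖ =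
        ‖(t' : FinAdele F) p‖ * max ‖algebraMap F (p.adicCompletion F) r * (t : FinAdele F) p‖
          ‖algebraMap F (p.adicCompletion F) s‖ ^ 2 *
          S.mulIndicator (fun p => ‖(ϖ.unit p : p.adicCompletion F)‖⁻¹) p := by
    have hp := congrArg (compFin p) h
    rw [map_mul, map_mul, compFin, map_aMat, map_aMat, ← bMat_zero, ← bMat_zero] at hp
    have := norm_det_mul_norm_eq (algebraMap F (p.adicCompletion F))
      (N := fun a b => max ‖a‖ ‖b‖ ^ 2)
      (fun a b c => by
        rw [norm_mul, norm_mul, ← mul_max_of_nonneg _ _ (norm_nonneg a), mul_pow])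
      (hdet p) hp hc hr hs
    rwa [mul_zero, zero_add] at this
  have hrs : r ≠ 0 ∨ s ≠ 0 := (bottomRow_ne_zero γ).imp
    (fun h h0 => h (by rw [hr, h0, mul_zero])) fun h h0 => h (by rw [hs, h0, mul_zero])
  have hδ : γ.val.det / c ^ 2 ≠ 0 := div_ne_zero γ.det_ne_zero (pow_ne_zero 2 hc)
  have hheight := (hasFiniteMulSupport_max_norm t hrs).fun_pow 2
  have hlevel : (S.mulIndicator fun p =>
      ‖(ϖ.unit p : p.adicCompletion F)‖⁻¹).HasFiniteMulSupport :=
    ((Ideal.finite_factors h𝔞).subset hS).subset Set.mulSupport_mulIndicator_subset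
  rw [finModulus, finModulus, finHeight, levelFactor, finprod_mem_def,
    ← finprod_mul_distrib (hasFiniteMulSupport_norm_algebraMap hδ)
      (hasFiniteMulSupport_norm_idele t),
    ← finprod_mul_distrib (hasFiniteMulSupport_norm_idele t') hheight,
    ← finprod_mul_distrib ((hasFiniteMulSupport_norm_idele t').fun_mul hheight) hlevel]
  exact finprod_congr hlocal

theorem prod_norm_mul_norm_eq {γ : GL (Fin 2) F} {y y' : (InfiniteAdeleRing F)ˣ}
    {x x' : InfiniteAdeleRing F} {i j : Fin (NumberField.classNumber F)}
    {k : GL (Fin 2) (Adele F)} (hk : ∀ v, compInf v k ∈ centerMul (KInfSubgroup v))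
    (h : rational γ * special θ y x i = special θ y' x' j * k) {c r s : F} (hc : c ≠ 0)
    (hr : γ.val 1 0 = c * r) (hs : γ.val 1 1 = c * s) :
    (∏ v : InfinitePlace F, ‖algebraMap F v.Completion (γ.val.det / c ^ 2)‖ ^ v.mult) *
      ‖(y : InfiniteAdeleRing F)‖ = ‖(y' : InfiniteAdeleRing F)‖ * archHeight y x r s := by
  rw [InfiniteAdeleRing.norm_def, InfiniteAdeleRing.norm_def, archHeight,
    ← Finset.prod_mul_distrib, ← Finset.prod_mul_distrib]
  refine Finset.prod_congr rfl fun v _ => ?_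
  rw [← mul_pow, ← mul_pow]
  congr 1
  have hv := congrArg (compInf v) h
  rw [map_mul, map_mul, compInf_special, compInf_special] at hv
  have := norm_det_mul_norm_eq (algebraMap F v.Completion)
    (N := fun a b => ‖a‖ ^ 2 + ‖b‖ ^ 2)
    (fun a b c => by rw [norm_mul, norm_mul, mul_pow, mul_pow, mul_add])
    ((norm_det_of_mem_centerMul_KInfSubgroup (hk v)).trans (mul_one _).symm) hv hc hr hs
  rwa [mul_one] at this

theorem norm_mul_finModulus_eq (h𝔞 : 𝔞 ≠ 0) {γ : GL (Fin 2) F} {y y' : (InfiniteAdeleRing F)ˣ}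
    {x x' : InfiniteAdeleRing F} {i j : Fin (NumberField.classNumber F)}
    {k : GL (Fin 2) (Adele F)} (hk : k ∈ KStarSubgroup ϖ 𝔞)
    (h : rational γ * special θ y x i = special θ y' x' j * k) {c r s : F} (hc : c ≠ 0)
    (hr : γ.val 1 0 = c * r) (hs : γ.val 1 1 = c * s) :
    ∃ S ⊆ {p : HeightOneSpectrum (𝓞 F) | p.asIdeal ∣ 𝔞},
      ‖(y : InfiniteAdeleRing F)‖ * finModulus (θ i) = ‖(y' : InfiniteAdeleRing F)‖ *
        (finModulus (θ j) * rowHeight y x (θ i) r s * levelFactor ϖ S) := by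
  obtain ⟨hkInf, hkFin⟩ := (mem_KStarSubgroup ϖ 𝔞).1 hk
  have hfin := congrArg finPart h
  rw [map_mul, map_mul, finPart_special, finPart_special, finPart_rational] at hfin
  obtain ⟨S, hS, hfinite⟩ :=
    finprod_norm_mul_finModulus_eq ϖ h𝔞 ((mem_finStar ϖ 𝔞).2 hkFin) hfin hc hr hs
  have hinfinite := prod_norm_mul_norm_eq hkInf h hc hr hs
  have hproduct := prod_norm_algebraMap_mul_finprod_eq_one
    (div_ne_zero γ.det_ne_zero (pow_ne_zero 2 hc))
  refine ⟨S, hS, ?_⟩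
  rw [← one_mul (‖(y : InfiniteAdeleRing F)‖ * _), ← hproduct, mul_mul_mul_comm, hinfinite,
    hfinite, rowHeight]
  ring

theorem mul_max_norm_sq_le {K : Type*} [NormedField K] {y : K} (hy : y ≠ 0) (x b : K) :
    ((1 + (‖x‖ + 1) / ‖y‖) ^ 2)⁻¹ * max ‖b‖ 1 ^ 2 ≤ ‖y‖ ^ 2 + ‖x + b‖ ^ 2 := by
  have hy' : 0 < ‖y‖ := norm_pos_iff.2 hy
  set m := max ‖y‖ ‖x + b‖ with hm
  have hbound : max ‖b‖ 1 ≤ (1 + (‖x‖ + 1) / ‖y‖) * m := by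
    have hb : ‖b‖ ≤ ‖x + b‖ + ‖x‖ := by simpa using norm_sub_le (x + b) x
    calc max ‖b‖ 1 ≤ ‖x + b‖ + (‖x‖ + 1) :=
          max_le (by linarith) (by linarith [norm_nonneg x, norm_nonneg (x + b)])
      _ = ‖x + b‖ + (‖x‖ + 1) / ‖y‖ * ‖y‖ := by rw [div_mul_cancel₀ _ hy'.ne']
      _ ≤ m + (‖x‖ + 1) / ‖y‖ * m := by
        gcongr
        exacts [le_max_right _ _, le_max_left _ _]
      _ = (1 + (‖x‖ + 1) / ‖y‖) * m := by ring
  have hmax : m ^ 2 ≤ ‖y‖ ^ 2 + ‖x + b‖ ^ 2 := by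
    rcases max_choice ‖y‖ ‖x + b‖ with h | h <;> rw [hm, h]
    exacts [le_add_of_nonneg_right (sq_nonneg _), le_add_of_nonneg_left (sq_nonneg _)]
  rw [inv_mul_le_iff₀ (by positivity)]
  calc max ‖b‖ 1 ^ 2 ≤ ((1 + (‖x‖ + 1) / ‖y‖) * m) ^ 2 := by gcongr
    _ ≤ (1 + (‖x‖ + 1) / ‖y‖) ^ 2 * (‖y‖ ^ 2 + ‖x + b‖ ^ 2) := by
      rw [mul_pow]
      gcongr

theorem exists_mul_le_archHeight (y : (InfiniteAdeleRing F)ˣ) (x : InfiniteAdeleRing F) :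
    ∃ C : ℝ, 0 < C ∧ ∀ s : F,
      C * (∏ v : InfinitePlace F, max ‖algebraMap F v.Completion s‖ 1 ^ v.mult) ^ 2 ≤
        archHeight y x 1 s := by
  have hy (v : InfinitePlace F) : (y : InfiniteAdeleRing F) v ≠ 0 :=
    (y.isUnit.map (evalArch v)).ne_zero
  refine ⟨∏ v : InfinitePlace F,
    ((1 + (‖x v‖ + 1) / ‖(y : InfiniteAdeleRing F) v‖) ^ 2)⁻¹ ^ v.mult,
    Finset.prod_pos fun v _ => by positivity, fun s => ?_⟩
  rw [archHeight, ← Finset.prod_pow, ← Finset.prod_mul_distrib]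
  refine Finset.prod_le_prod (fun v _ => by positivity) fun v _ => ?_
  rw [map_one, one_mul, one_mul, pow_right_comm, ← mul_pow]
  exact pow_le_pow_left₀ (by positivity) (mul_max_norm_sq_le (hy v) _ _) _

theorem finModulus_sq_mul_le_finHeight {t : (FinAdele F)ˣ}
    (ht : ∀ p, Valued.v ((t : FinAdele F) p) ≤ 1) (s : F) :
    finModulus t ^ 2 * (∏ᶠ p : HeightOneSpectrum (𝓞 F),
      max ‖algebraMap F (p.adicCompletion F) s‖ 1) ^ 2 ≤ finHeight t 1 s := by
  have hmodulus := hasFiniteMulSupport_norm_idele t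
  have hheight := hasFiniteMulSupport_max_norm t (s := s) (Or.inl one_ne_zero)
  have hmax : (fun p : HeightOneSpectrum (𝓞 F) =>
      max ‖algebraMap F (p.adicCompletion F) s‖ 1).HasFiniteMulSupport := by
    have hone (p : HeightOneSpectrum (𝓞 F)) : ((1 : (FinAdele F)ˣ) : FinAdele F) p = 1 := rfl
    simpa only [map_one, hone, mul_one, norm_one, max_comm (1 : ℝ)] using
      hasFiniteMulSupport_max_norm 1 (s := s) (Or.inl one_ne_zero)
  rw [finModulus, finHeight, ← mul_pow, ← finprod_mul_distrib hmodulus hmax,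
    ← finprod_pow hheight]
  refine pow_le_pow_left₀ (finprod_nonneg fun p => by positivity) ?_ 2
  refine finprod_le_finprod (hmodulus.fun_mul hmax) (fun p => by positivity) hheight fun p => ?_
  have htp : ‖(t : FinAdele F) p‖ ≤ 1 := Valued.toNormedField.norm_le_one_iff.2 (ht p)
  simp only [map_one, one_mul]
  rw [mul_max_of_nonneg _ _ (norm_nonneg _), mul_one, max_comm]
  exact max_le_max le_rfl (mul_le_of_le_one_left (norm_nonneg _) htp)

theorem exists_mul_mulHeight₁_sq_le_rowHeight (y : (InfiniteAdeleRing F)ˣ)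
    (x : InfiniteAdeleRing F) {t : (FinAdele F)ˣ}
    (ht : ∀ p, Valued.v ((t : FinAdele F) p) ≤ 1) :
    ∃ C : ℝ, 0 < C ∧ ∀ s : F, C * Height.mulHeight₁ s ^ 2 ≤ rowHeight y x t 1 s := by
  obtain ⟨C, hC, harch⟩ := exists_mul_le_archHeight y x
  refine ⟨C * finModulus t ^ 2, mul_pos hC (pow_pos (finModulus_pos t) 2), fun s => ?_⟩
  rw [mulHeight₁_eq_prod_mul_finprod, mul_pow, mul_mul_mul_comm]
  exact mul_le_mul (harch s) (finModulus_sq_mul_le_finHeight ht s) (by positivity)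
    (archHeight_nonneg y x 1 s)

/-- Representatives of the nonzero rows over `F` up to scaling. -/
def normalizedRows (F : Type*) [Field F] : Set (F × F) :=
  insert (0, 1) {q | q.1 = 1}

theorem exists_mem_normalizedRows {F : Type*} [Field F] (γ : GL (Fin 2) F) :
    ∃ c ≠ 0, ∃ q ∈ normalizedRows F, γ.val 1 0 = c * q.1 ∧ γ.val 1 1 = c * q.2 := by
  obtain hc | hc := eq_or_ne (γ.val 1 0) 0
  · exact ⟨γ.val 1 1, (bottomRow_ne_zero γ).resolve_left (· hc), (0, 1), Or.inl rfl,
      by rw [hc, mul_zero], (mul_one _).symm⟩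
  · exact ⟨γ.val 1 0, hc, (1, γ.val 1 1 / γ.val 1 0), Or.inr rfl, (mul_one _).symm,
      (mul_div_cancel₀ _ hc).symm⟩

theorem finite_setOf_rowHeight_le (y : (InfiniteAdeleRing F)ˣ) (x : InfiniteAdeleRing F)
    {t : (FinAdele F)ˣ} (ht : ∀ p, Valued.v ((t : FinAdele F) p) ≤ 1) (B : ℝ) :
    {q ∈ normalizedRows F | rowHeight y x t q.1 q.2 ≤ B}.Finite := by
  obtain ⟨C, hC, hle⟩ := exists_mul_mulHeight₁_sq_le_rowHeight y x ht
  refine (((NumberField.finite_setOfPred_mulHeight₁_le F (B / C)).image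
    fun s => ((1 : F), s)).insert (0, 1)).subset ?_
  rintro ⟨r, s⟩ ⟨hq | (rfl : r = 1), hB⟩
  · exact Or.inl hq
  · refine Or.inr ⟨s, ?_, rfl⟩
    rw [Set.mem_ofPred_eq, le_div_iff₀ hC, mul_comm]
    refine le_trans ?_ ((hle s).trans hB)
    gcongr
    exact le_self_pow₀ (Height.one_le_mulHeight₁ s) two_ne_zero

theorem exists_norm_eq_div_and_rowHeight_le (h𝔞 : 𝔞 ≠ 0) {γ : GL (Fin 2) F}
    {y y' : (InfiniteAdeleRing F)ˣ} {x x' : InfiniteAdeleRing F}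
    {i j : Fin (NumberField.classNumber F)} {k : GL (Fin 2) (Adele F)}
    (hk : k ∈ KStarSubgroup ϖ 𝔞) (h : rational γ * special θ y x i = special θ y' x' j * k)
    (hle : ‖(y : InfiniteAdeleRing F)‖ ≤ ‖(y' : InfiniteAdeleRing F)‖) :
    ∃ S ⊆ {p : HeightOneSpectrum (𝓞 F) | p.asIdeal ∣ 𝔞}, ∃ q ∈ normalizedRows F,
      rowHeight y x (θ i) q.1 q.2 ≤ finModulus (θ i) / finModulus (θ j) ∧
      ‖(y' : InfiniteAdeleRing F)‖ = ‖(y : InfiniteAdeleRing F)‖ * finModulus (θ i) /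
        (finModulus (θ j) * rowHeight y x (θ i) q.1 q.2 * levelFactor ϖ S) := by
  obtain ⟨c, hc, q, hq, hr, hs⟩ := exists_mem_normalizedRows γ
  obtain ⟨S, hS, heq⟩ := norm_mul_finModulus_eq ϖ h𝔞 hk h hc hr hs
  have hpos : 0 < ‖(y : InfiniteAdeleRing F)‖ * finModulus (θ i) :=
    mul_pos (infiniteAdele_norm_pos y) (finModulus_pos _)
  refine ⟨S, hS, q, hq, ?_, eq_div_of_mul_eq (right_ne_zero_of_mul (heq ▸ hpos.ne')) heq.symm⟩
  have hj := finModulus_pos (θ j)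
  have hW := rowHeight_nonneg y x (θ i) q.1 q.2
  rw [le_div_iff₀ hj]
  refine le_of_mul_le_mul_left ?_ (infiniteAdele_norm_pos y)
  calc ‖(y : InfiniteAdeleRing F)‖ * (rowHeight y x (θ i) q.1 q.2 * finModulus (θ j))
      ≤ ‖(y' : InfiniteAdeleRing F)‖ *
          (finModulus (θ j) * rowHeight y x (θ i) q.1 q.2 * levelFactor ϖ S) := by
        rw [mul_comm (rowHeight _ _ _ _ _)]
        exact mul_le_mul hle (le_mul_of_one_le_right (by positivity) (one_le_levelFactor ϖ S))
          (by positivity) (infiniteAdele_norm_pos y').le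
    _ = ‖(y : InfiniteAdeleRing F)‖ * finModulus (θ i) := heq.symm

theorem finite_setOf_norm_special (hθ : IsClassRepresentatives θ) (h𝔞 : 𝔞 ≠ 0)
    (y : (InfiniteAdeleRing F)ˣ) (x : InfiniteAdeleRing F)
    (i : Fin (NumberField.classNumber F)) :
    {N : ℝ | ‖(y : InfiniteAdeleRing F)‖ ≤ N ∧ ∃ (y' : (InfiniteAdeleRing F)ˣ)
      (x' : InfiniteAdeleRing F) (j : Fin (NumberField.classNumber F)) (γ : GL (Fin 2) F),
      ∃ k ∈ KStarSubgroup ϖ 𝔞, rational γ * special θ y x i = special θ y' x' j * k ∧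
        N = ‖(y' : InfiniteAdeleRing F)‖}.Finite := by
  have hsets : {S | S ⊆ {p : HeightOneSpectrum (𝓞 F) | p.asIdeal ∣ 𝔞}}.Finite :=
    (Ideal.finite_factors h𝔞).finite_subsets
  have hrows (j : Fin (NumberField.classNumber F)) :=
    finite_setOf_rowHeight_le y x (hθ.integral i) (finModulus (θ i) / finModulus (θ j))
  let candidate (j : Fin (NumberField.classNumber F))
      (a : Set (HeightOneSpectrum (𝓞 F)) × F × F) : ℝ :=
    ‖(y : InfiniteAdeleRing F)‖ * finModulus (θ i) /
      (finModulus (θ j) * rowHeight y x (θ i) a.2.1 a.2.2 * levelFactor ϖ a.1)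
  refine (Set.finite_iUnion fun j => (hsets.prod (hrows j)).image (candidate j)).subset ?_
  rintro N ⟨hN, y', x', j, γ, k, hk, h, rfl⟩
  obtain ⟨S, hS, q, hq, hqB, hnorm⟩ := exists_norm_eq_div_and_rowHeight_le ϖ h𝔞 hk h hN
  exact Set.mem_iUnion.2 ⟨j, (S, q), ⟨hS, hq, hqB⟩, hnorm.symm⟩

theorem exists_eq_rational_mul_genDomain (hθ : IsClassRepresentatives θ) (h𝔞 : 𝔞 ≠ 0)
    (g : GL (Fin 2) (Adele F)) :
    ∃ γ y x i, ∃ k ∈ KStar ϖ 𝔞, special θ y x i ∈ genDomain ϖ θ 𝔞 ∧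
      g = rational γ * special θ y x i * k := by
  simp only [genDomain, mem_KStar_iff_mem_KStarSubgroup]
  obtain ⟨γ, y, x, i, k, hk, hg⟩ := exists_eq_rational_mul_special_mul ϖ hθ h𝔞 g
  rw [mem_KStar_iff_mem_KStarSubgroup] at hk
  obtain ⟨N, ⟨hN, y', x', j, γ', k', hk', h', rfl⟩, hmax⟩ := Set.exists_max_image _ id
    (finite_setOf_norm_special ϖ hθ h𝔞 y x i) ⟨‖(y : InfiniteAdeleRing F)‖, le_rfl, y, x, i, 1, 1,
      one_mem _, by simp, rfl⟩
  refine ⟨γ * γ'⁻¹, y', x', j, k' * k, mul_mem hk' hk, ⟨y', x', j, rfl, ?_⟩, ?_⟩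
  · rintro y'' x'' l ⟨γ'', k'', hk'', h''⟩
    by_contra! hlt
    refine hlt.not_ge (hmax _ ⟨hN.trans hlt.le, y'', x'', l, γ'' * γ', k''⁻¹ * k',
      mul_mem (inv_mem hk'') hk', ?_, rfl⟩)
    rw [map_mul, mul_assoc, h', h'']
    group
  · rw [map_mul, map_inv, hg, mul_assoc (_ * _) (special θ y' x' j), ← mul_assoc (special _ _ _ _),
      ← h']
    group

end Maximum

/-! ### Passage to level `𝔫` -/

section Level

theorem antiMat_one_mul_aMat {R : Type*} [CommRing R] (s : Rˣ) :
    antiMat 1 * aMat s = antiMat s := by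
  apply Units.ext
  simp

theorem inv_antiMat_mul_antiMat {R : Type*} [CommRing R] {t s r : Rˣ} (h : s * s = t * r) :
    (antiMat t)⁻¹ * antiMat s = zMat s⁻¹ * antiMat s * antiMat r := by
  have hR : (s : R) * s = t * r := by exact_mod_cast congrArg Units.val h
  rw [inv_mul_eq_iff_eq_mul, zMat_inv, mul_assoc, ← mul_assoc (antiMat t), eq_comm, ← zMat_inv,
    ← zMat_comm, zMat_inv, mul_assoc, inv_mul_eq_iff_eq_mul]
  apply Units.ext
  simp [hR]

variable {F : Type*} [Field F] [NumberField F] {p : HeightOneSpectrum (𝓞 F)}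

theorem antiMat_mem_KFin {u : (p.adicCompletion F)ˣ}
    (hu : Valued.v (u : p.adicCompletion F) = 1) : antiMat u ∈ KFin p := by
  refine mem_KFin_iff.2 ⟨fun i j => ?_, by simpa using hu⟩
  fin_cases i <;> fin_cases j <;> simp [hu]

theorem valued_eq_one_of_zMat_mem_KFin {z : (p.adicCompletion F)ˣ} (hz : zMat z ∈ KFin p) :
    Valued.v (z : p.adicCompletion F) = 1 := by
  simpa [← sq] using (mem_KFin_iff.1 hz).2

theorem mem_K1Fin_zero {g : GL (Fin 2) (p.adicCompletion F)} (hg : g ∈ KFin p) :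
    g ∈ K1Fin p 0 := by
  have hentry := (mem_KFin_iff.1 hg).1
  refine ⟨hg, ?_, by simpa using hentry 1 0⟩
  simpa using (Valuation.map_sub _ _ _).trans (max_le (hentry 0 0) (map_one Valued.v).le)

theorem one_mem_K1Fin (n : ℕ) : (1 : GL (Fin 2) (p.adicCompletion F)) ∈ K1Fin p n :=
  ⟨one_mem _, by simp, by simp⟩

theorem ordAt_eq_zero_of_not_dvd {𝔫 : Ideal (𝓞 F)} (hp : ¬ p.asIdeal ∣ 𝔫) : ordAt 𝔫 p = 0 := by
  have h𝔫 : 𝔫 ≠ 0 := by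
    rintro rfl
    exact hp (dvd_zero _)
  exact not_not.1 (mt (asIdeal_dvd_iff_ordAt_ne_zero h𝔫 p).2 hp)

variable (ϖ : Uniformizers F) (𝔫 : Ideal (𝓞 F))

/-- The local component at `𝔭` of the matrix by which elements of `GL₂(𝔸_F)` are translated in
order to pass from the group `K^*` to level `𝔫`. -/
noncomputable def levelShift (p : HeightOneSpectrum (𝓞 F)) : GL (Fin 2) (p.adicCompletion F) :=
  antiMat (ϖ.unit p ^ ord1 𝔫 p)

theorem levelShift_eventually_mem_KFin :
    ∀ᶠ p in Filter.cofinite, levelShift ϖ 𝔫 p ∈ KFin p := by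
  filter_upwards [ordAt_eventually_eq_zero 𝔫] with p hp
  exact antiMat_mem_KFin (by simp [ord1, hp])

/-- The set of possible components at `𝔭` of the elements of `𝒥_𝔫`. -/
def localJ (p : HeightOneSpectrum (𝓞 F)) : Set (GL (Fin 2) (p.adicCompletion F)) :=
  {j | (p.asIdeal ∣ 𝔫 → (∃ k ∈ KFin p, j = k * aMat (ϖ.unit p ^ ord1 𝔫 p)) ∧
    n1Inv ϖ 𝔫 p j = ord0 𝔫 p) ∧ (¬ p.asIdeal ∣ 𝔫 → j = 1)}

variable {ϖ 𝔫}

theorem mem_calJ_iff {g : GL (Fin 2) (FinAdele F)} :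
    g ∈ calJ ϖ 𝔫 𝔫 ↔ ∀ p, compFin p g ∈ localJ ϖ 𝔫 p :=
  ⟨fun h p => ⟨fun hp => ⟨h.1.1 p hp, h.2 p hp⟩, h.1.2 p⟩,
    fun h => ⟨⟨fun p hp => ((h p).1 hp).1, fun p => (h p).2⟩, fun p hp => ((h p).1 hp).2⟩⟩

theorem eventually_mem_KFin_of_mem_localJ
    {j : ∀ p : HeightOneSpectrum (𝓞 F), GL (Fin 2) (p.adicCompletion F)}
    (hj : ∀ p, j p ∈ localJ ϖ 𝔫 p) : ∀ᶠ p in Filter.cofinite, j p ∈ KFin p := by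
  filter_upwards [ordAt_eventually_eq_zero 𝔫] with p hp
  by_cases hdvd : p.asIdeal ∣ 𝔫
  · obtain ⟨⟨k, hk, hjk⟩, -⟩ := (hj p).1 hdvd
    have haMat : aMat (ϖ.unit p ^ ord1 𝔫 p) = 1 := by
      apply Units.ext
      simp [ord1, hp, Matrix.one_fin_two]
    rwa [hjk, haMat, mul_one]
  · rw [(hj p).2 hdvd]
    exact one_mem _

theorem n1Inv_mul_levelShift {u : GL (Fin 2) (p.adicCompletion F)} (hu : u ∈ K0Subgroup p 1)
    (hord : ord1 𝔫 p = ord0 𝔫 p + 1) : n1Inv ϖ 𝔫 p (u * levelShift ϖ 𝔫 p) = ord0 𝔫 p := by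
  have hc : (u * levelShift ϖ 𝔫 p).val 1 0 =
      u.val 1 1 * (ϖ.unit p : p.adicCompletion F) ^ ord1 𝔫 p := by
    simp [levelShift, Matrix.mul_apply, Fin.sum_univ_two]
  have hd : (u * levelShift ϖ 𝔫 p).val 1 1 = u.val 1 0 := by
    simp [levelShift, Matrix.mul_apply, Fin.sum_univ_two]
  have hu11 := (valued_diag_of_mem_K0Fin le_rfl hu).2
  refine if_pos (lInv_le_of_valued_row_le (m := ord0 𝔫 p) ϖ (Nat.sub_le _ _) ?_ ?_)
  · rw [hc]
    exact mul_ne_zero ((Valuation.ne_zero_iff Valued.v).1 (by simp [hu11]))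
      (pow_ne_zero _ (ϖ.unit p).ne_zero)
  · have hexp : WithZero.exp (-1 : ℤ) ^ ord1 𝔫 p * WithZero.exp (ord0 𝔫 p : ℤ)
        = WithZero.exp (-((1 : ℕ) : ℤ)) := by
      rw [← WithZero.exp_nsmul, ← WithZero.exp_add, hord]
      congr 1
      simp
    rw [hc, hd, map_mul, hu11, one_mul, map_pow, valued_unit, hexp]
    exact hu.2

theorem mul_levelShift_mem_localJ {u : GL (Fin 2) (p.adicCompletion F)} (hp : p.asIdeal ∣ 𝔫)
    (hu : u ∈ KFin p) (hn1 : n1Inv ϖ 𝔫 p (u * levelShift ϖ 𝔫 p) = ord0 𝔫 p) :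
    u * levelShift ϖ 𝔫 p ∈ localJ ϖ 𝔫 p := by
  refine ⟨fun _ => ⟨⟨u * antiMat 1, mul_mem hu (antiMat_mem_KFin (by simp)), ?_⟩, hn1⟩,
    fun h => absurd hp h⟩
  rw [mul_assoc, antiMat_one_mul_aMat, levelShift]

theorem etaLocal_of_dvd {𝔏 : Ideal (𝓞 F)} (h : p.asIdeal ∣ 𝔏) :
    etaLocal ϖ 𝔫 𝔏 p = antiMat (ϖ.unit p ^ ordAt 𝔫 p) := if_pos h

theorem etaLocal_one : etaLocal ϖ 𝔫 1 p = 1 :=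
  if_neg fun h => p.prime.not_isUnit (isUnit_of_dvd_one h)

theorem etaLocal_congr {𝔏 𝔏' : Ideal (𝓞 F)} (h : p.asIdeal ∣ 𝔏 ↔ p.asIdeal ∣ 𝔏') :
    etaLocal ϖ 𝔫 𝔏 p = etaLocal ϖ 𝔫 𝔏' p := by
  classical
  exact if_congr h rfl rfl

theorem inv_antiMat_mul_levelShift (hp : p.asIdeal ∣ sqfreePart 𝔫) :
    (antiMat (ϖ.unit p))⁻¹ * levelShift ϖ 𝔫 p =
      zMat (ϖ.unit p ^ ord1 𝔫 p)⁻¹ * levelShift ϖ 𝔫 p * etaLocal ϖ 𝔫 (sqfreePart 𝔫) p := by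
  rw [etaLocal_of_dvd hp]
  refine inv_antiMat_mul_antiMat ?_
  have hord : ord1 𝔫 p + ord1 𝔫 p = ordAt 𝔫 p + 1 := by
    have := (dvd_sqfreePart_iff 𝔫 p).1 hp
    unfold ord0 ord1 at *
    omega
  rw [← pow_add, ← pow_succ', hord]

theorem exists_eq_zMat_mul_localJ_mul_etaLocal (hp : p.asIdeal ∣ 𝔫)
    {κ : GL (Fin 2) (p.adicCompletion F)} (hκ : κ ∈ localStar ϖ (sqfreePart 𝔫) p) :
    ∃ z, ∃ j ∈ localJ ϖ 𝔫 p, ∃ 𝔏, 𝔏 ∣ sqfreePart 𝔫 ∧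
      κ * levelShift ϖ 𝔫 p = zMat z * j * etaLocal ϖ 𝔫 𝔏 p := by
  unfold localStar at hκ
  split_ifs at hκ with hsq
  · have hmem (u) (hu : u ∈ K0Subgroup p 1) : u * levelShift ϖ 𝔫 p ∈ localJ ϖ 𝔫 p :=
      mul_levelShift_mem_localJ hp hu.1 (n1Inv_mul_levelShift hu ((dvd_sqfreePart_iff 𝔫 p).1 hsq))
    obtain ⟨z, u, hu, hκu⟩ | ⟨z, u, hu, hκu⟩ := mem_or_mul_antiMat_mem_centerMul ϖ hκ
    · refine ⟨z, _, hmem u hu, 1, one_dvd _, ?_⟩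
      rw [etaLocal_one, mul_one, hκu, mul_assoc]
    · refine ⟨z * (ϖ.unit p ^ ord1 𝔫 p)⁻¹, _, hmem u hu, sqfreePart 𝔫, dvd_rfl, ?_⟩
      rw [eq_mul_inv_of_mul_eq hκu, mul_assoc, inv_antiMat_mul_levelShift hsq, zMat_mul]
      simp only [← mul_assoc]
      rw [mul_assoc (zMat z) u, ← zMat_comm, ← mul_assoc]
  · obtain ⟨z, u, hu, rfl⟩ := hκ
    refine ⟨z, _, mul_levelShift_mem_localJ hp hu ?_, 1, one_dvd _, ?_⟩
    · rw [n1Inv, ord1_eq_ord0_of_not_dvd hsq, ite_self]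
    · rw [etaLocal_one, mul_one, mul_assoc]

theorem exists_eq_zMat_mul_localJ_mul_etaLocal_mul {κ : GL (Fin 2) (p.adicCompletion F)}
    (hκ : κ ∈ localStar ϖ (sqfreePart 𝔫) p) :
    ∃ z, ∃ j ∈ localJ ϖ 𝔫 p, ∃ 𝔏, 𝔏 ∣ sqfreePart 𝔫 ∧ ∃ u ∈ K1Fin p (ordAt 𝔫 p),
      κ * levelShift ϖ 𝔫 p = zMat z * j * etaLocal ϖ 𝔫 𝔏 p * u := by
  by_cases hp : p.asIdeal ∣ 𝔫
  · obtain ⟨z, j, hj, 𝔏, h𝔏, h⟩ := exists_eq_zMat_mul_localJ_mul_etaLocal hp hκ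
    exact ⟨z, j, hj, 𝔏, h𝔏, 1, one_mem_K1Fin _, by rw [mul_one, h]⟩
  · have hord := ordAt_eq_zero_of_not_dvd hp
    have hsq : ¬ p.asIdeal ∣ sqfreePart 𝔫 := by
      rw [dvd_sqfreePart_iff]
      unfold ord0 ord1
      omega
    rw [localStar, if_neg hsq] at hκ
    obtain ⟨z, u, hu, rfl⟩ := hκ
    have hshift : levelShift ϖ 𝔫 p ∈ KFin p := antiMat_mem_KFin (by simp [ord1, hord])
    refine ⟨z, 1, ⟨fun h => absurd h hp, fun _ => rfl⟩, 1, one_dvd _, u * levelShift ϖ 𝔫 p, ?_, ?_⟩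
    · rw [hord]
      exact mem_K1Fin_zero (mul_mem hu hshift)
    · rw [etaLocal_one, mul_one, mul_one, mul_assoc]

end Level

section Ideles

variable {F : Type*} [Field F] [NumberField F]

theorem exists_zMat_with_components (y : ∀ v : InfinitePlace F, v.Completionˣ)
    (t : ∀ p : HeightOneSpectrum (𝓞 F), (p.adicCompletion F)ˣ)
    (ht : ∀ᶠ p in Filter.cofinite, Valued.v (t p : p.adicCompletion F) = 1) :
    ∃ z : (Adele F)ˣ, (∀ v, compInf v (zMat z) = zMat (y v)) ∧
      ∀ p, compFin p (finPart (zMat z)) = zMat (t p) := by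
  let a : FinAdele F := ⟨fun p => (t p : p.adicCompletion F), ht.mono fun p hp => hp.le⟩
  obtain ⟨s, hs⟩ : IsUnit a := FiniteAdeleRing.isUnit_iff.2 ⟨fun p => (t p).ne_zero, ht⟩
  let z : (Adele F)ˣ := MulEquiv.prodUnits.symm (archUnit y, s)
  refine ⟨z, fun v => ?_, fun p => ?_⟩
  · rw [compInf, map_zMat]
    congr 1
  · rw [compFin, finPart, map_zMat, map_zMat]
    exact congrArg zMat (Units.ext (congrArg (evalFin p) hs))

theorem compFin_finOfLocal (g : ∀ p : HeightOneSpectrum (𝓞 F), GL (Fin 2) (p.adicCompletion F))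
    (h : ∀ᶠ p in Filter.cofinite, g p ∈ KFin p) (p : HeightOneSpectrum (𝓞 F)) :
    compFin p (finOfLocal g h) = g p := Units.ext rfl

theorem eventually_compFin_mem_KFin (g : GL (Fin 2) (FinAdele F)) :
    ∀ᶠ p in Filter.cofinite, compFin p g ∈ KFin p := by
  have hentry : ∀ᶠ p in Filter.cofinite, ∀ ij : Fin 2 × Fin 2,
      Valued.v ((compFin p g).val ij.1 ij.2) ≤ 1 :=
    Filter.eventually_all.2 fun ij => (g.val ij.1 ij.2).2
  have hdet : ∀ᶠ p in Filter.cofinite,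
      Valued.v ((Matrix.GeneralLinearGroup.det g : FinAdele F) p) = 1 :=
    FiniteAdeleRing.unitsEquiv_finite_valued_eq_one (Matrix.GeneralLinearGroup.det g)
  filter_upwards [hentry, hdet] with p hp_entry hp_det
  refine mem_KFin_iff.2 ⟨fun i j => hp_entry (i, j), ?_⟩
  rw [← hp_det]
  congr 1

theorem glPair_mul (b b' : GL (Fin 2) (InfiniteAdeleRing F)) (g g' : GL (Fin 2) (FinAdele F)) :
    glPair (b * b') (g * g') = glPair b g * glPair b' g' := by
  apply Units.ext
  ext i j
  rw [Units.val_mul, Matrix.mul_apply, Fin.sum_univ_two]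
  refine Prod.ext ?_ ?_
  · exact (Matrix.mul_apply ..).trans (Fin.sum_univ_two _)
  · exact (Matrix.mul_apply ..).trans (Fin.sum_univ_two _)

end Ideles

section Decomposition

variable {F : Type*} [Field F] [NumberField F] {ϖ : Uniformizers F} {𝔫 : Ideal (𝓞 F)}

theorem eventually_valued_eq_one {𝔏 : Ideal (𝓞 F)} (g : GL (Fin 2) (FinAdele F))
    {z : ∀ p : HeightOneSpectrum (𝓞 F), (p.adicCompletion F)ˣ}
    {j u : ∀ p : HeightOneSpectrum (𝓞 F), GL (Fin 2) (p.adicCompletion F)}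
    (hj : ∀ p, j p ∈ localJ ϖ 𝔫 p) (hu : ∀ p, u p ∈ KFin p)
    (h : ∀ p, compFin p g = zMat (z p) * j p * etaLocal ϖ 𝔫 𝔏 p * u p) :
    ∀ᶠ p in Filter.cofinite, Valued.v (z p : p.adicCompletion F) = 1 := by
  filter_upwards [eventually_compFin_mem_KFin g, eventually_mem_KFin_of_mem_localJ hj,
    etaLocal_eventually_mem ϖ 𝔫 𝔏] with p hg hjp heta
  refine valued_eq_one_of_zMat_mem_KFin ?_
  rwa [h p, Subgroup.mul_mem_cancel_right _ (hu p), Subgroup.mul_mem_cancel_right _ heta,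
    Subgroup.mul_mem_cancel_right _ hjp] at hg

theorem exists_eq_zMat_mul_calJ_mul_eta_mul {κ : GL (Fin 2) (Adele F)}
    (hκ : κ ∈ KStarSubgroup ϖ (sqfreePart 𝔫)) :
    ∃ 𝔏, 𝔏 ∣ sqfreePart 𝔫 ∧ ∃ z, ∃ j ∈ calJ ϖ 𝔫 𝔫, ∃ k ∈ K1 𝔫,
      κ * glPair 1 (finOfLocal _ (levelShift_eventually_mem_KFin ϖ 𝔫)) =
        zMat z * glPair 1 j * eta ϖ 𝔫 𝔏 * k := by
  set shift := finOfLocal _ (levelShift_eventually_mem_KFin ϖ 𝔫) with hshift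
  obtain ⟨hκInf, hκFin⟩ := (mem_KStarSubgroup ϖ _).1 hκ
  choose y k hk hκk using hκInf
  choose t j hj 𝔏loc h𝔏loc u hu hdec using fun p =>
    exists_eq_zMat_mul_localJ_mul_etaLocal_mul (hκFin p)
  obtain ⟨𝔏, h𝔏, h𝔏mem⟩ := exists_dvd_forall_asIdeal_dvd_iff_mem (sqfreePart_ne_zero 𝔫)
    (T := {p | p.asIdeal ∣ 𝔏loc p}) fun p hp => dvd_trans hp (h𝔏loc p)
  have hdec' (p) : compFin p (finPart κ * shift) =
      zMat (t p) * j p * etaLocal ϖ 𝔫 𝔏 p * u p := by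
    rw [map_mul, hshift, compFin_finOfLocal, hdec p, etaLocal_congr (h𝔏mem p)]
  obtain ⟨z, hzInf, hzFin⟩ := exists_zMat_with_components y t
    (eventually_valued_eq_one _ hj (fun p => (hu p).1) hdec')
  have hjK := eventually_mem_KFin_of_mem_localJ hj
  refine ⟨𝔏, h𝔏, z, finOfLocal j hjK, mem_calJ_iff.2 fun p => ?_,
    (zMat z * glPair 1 (finOfLocal j hjK) * eta ϖ 𝔫 𝔏)⁻¹ * (κ * glPair 1 shift),
    ⟨fun v => ?_, fun p => ?_⟩, (mul_inv_cancel_left _ _).symm⟩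
  · rw [compFin_finOfLocal]
    exact hj p
  · simp only [map_mul, map_inv, eta, compInf_glPair, map_one, mul_one, hzInf, hκk,
      inv_mul_cancel_left]
    exact hk v
  · have hcomp : compFin p (finPart (κ * glPair 1 shift)) = compFin p (finPart κ * shift) := by
      rw [map_mul, finPart_glPair]
    rw [map_mul, map_mul, map_inv, map_inv, hcomp, hdec']
    simp only [map_mul, eta, finPart_glPair, compFin_finOfLocal, hzFin, inv_mul_cancel_left]
    exact hu p

theorem exists_eq_zMat_mul_rational_mul_glPair_mul_eta_mul
    {θ : Fin (NumberField.classNumber F) → (FinAdele F)ˣ} (hθ : IsClassRepresentatives θ)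
    (g : GL (Fin 2) (Adele F)) : ∃ 𝔏 : Ideal (𝓞 F), 𝔏 ∣ sqfreePart 𝔫 ∧
      ∃ i : Fin (NumberField.classNumber F), ∃ (z : (Adele F)ˣ) (γ : GL (Fin 2) F),
        ∃ j ∈ calJ ϖ 𝔫 𝔫, ∃ b ∈ calF ϖ θ (sqfreePart 𝔫), ∃ k ∈ K1 𝔫,
          g = zMat z * rational γ * glPair b (aMat (θ i) * j) * eta ϖ 𝔫 𝔏 * k := by
  let shift := glPair 1 (finOfLocal _ (levelShift_eventually_mem_KFin ϖ 𝔫))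
  obtain ⟨γ, y, x, i, κ, hκ, hdom, hg⟩ :=
    exists_eq_rational_mul_genDomain ϖ hθ (sqfreePart_ne_zero 𝔫) (g * shift⁻¹)
  obtain ⟨𝔏, h𝔏, z, j, hj, k, hk, hκshift⟩ := exists_eq_zMat_mul_calJ_mul_eta_mul
    ((mem_KStar_iff_mem_KStarSubgroup ϖ _).1 hκ)
  refine ⟨𝔏, h𝔏, i, z, γ, j, hj, bMat y x, ⟨y, x, rfl, i, hdom⟩, k, hk, ?_⟩
  have hspecial : glPair (bMat y x) (aMat (θ i) * j) = special θ y x i * glPair 1 j := by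
    rw [special, ← glPair_mul, mul_one]
  calc g = rational γ * special θ y x i * (κ * shift) := by
        rw [← mul_assoc, ← hg, inv_mul_cancel_right]
    _ = rational γ * special θ y x i * (zMat z * glPair 1 j * eta ϖ 𝔫 𝔏 * k) := by
        rw [hκshift]
    _ = zMat z * rational γ * glPair (bMat y x) (aMat (θ i) * j) * eta ϖ 𝔫 𝔏 * k := by
        rw [hspecial]
        simp only [← mul_assoc]
        rw [← zMat_comm]
        simp only [mul_assoc]

theorem IsFormOfLevel.enorm_apply_eq_enorm_twist {ω : (Adele F)ˣ →* Circle}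
    {φ : GL (Fin 2) (Adele F) → ℂ} (hφ : IsFormOfLevel φ ω 𝔫) (ϖ : Uniformizers F)
    (𝔏 : Ideal (𝓞 F)) (χ : (Adele F)ˣ →* Circle) (z : (Adele F)ˣ) (γ : GL (Fin 2) F)
    (g : GL (Fin 2) (Adele F)) {k : GL (Fin 2) (Adele F)} (hk : k ∈ K1 𝔫) :
    ‖φ (zMat z * rational γ * g * eta ϖ 𝔫 𝔏 * k)‖ₑ = ‖twist ϖ 𝔫 𝔏 ω χ φ g‖ₑ := by
  have enorm_circle (c : Circle) : ‖(c : ℂ)‖ₑ = 1 := by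
    rw [← ofReal_norm, Circle.norm_coe, ENNReal.ofReal_one]
  rw [hφ.right_invariant _ k hk, mul_assoc, mul_assoc, hφ.central, hφ.left_invariant, twist,
    enorm_mul, enorm_mul, enorm_circle, enorm_circle]

end Decomposition

end AdelicGL2

theorem mainTheorem6 {F : Type*} [Field F] [NumberField F] (ϖ : Uniformizers F)
    (θ : Fin (NumberField.classNumber F) → (FinAdele F)ˣ) (hθ : IsClassRepresentatives θ)
    (𝔫 : Ideal (𝓞 F)) (h𝔫 : 𝔫 ≠ 0) :
    (∀ g : GL (Fin 2) (Adele F), ∃ 𝔏 : Ideal (𝓞 F), 𝔏 ∣ sqfreePart 𝔫 ∧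
      ∃ i : Fin (NumberField.classNumber F), ∃ (z : (Adele F)ˣ) (γ : GL (Fin 2) F),
        ∃ j ∈ calJ ϖ 𝔫 𝔫, ∃ b ∈ calF ϖ θ (sqfreePart 𝔫), ∃ k ∈ K1 𝔫,
          g = zMat z * rational γ * glPair b (aMat (θ i) * j) * eta ϖ 𝔫 𝔏 * k) ∧
    (∀ (ω : (Adele F)ˣ →* Circle) (χ : Ideal (𝓞 F) → (Adele F)ˣ →* Circle)
      (φ : GL (Fin 2) (Adele F) → ℂ),
      (∀ 𝔏, 𝔏 ∣ sqfreePart 𝔫 → IsTwistCharacter ω 𝔏 (χ 𝔏)) → IsFormOfLevel φ ω 𝔫 →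
      (⨆ g : GL (Fin 2) (Adele F), ‖φ g‖ₑ) ≤
        (⨆ (𝔏 : Ideal (𝓞 F)) (_ : 𝔏 ∣ sqfreePart 𝔫) (i : Fin (NumberField.classNumber F))
          (j ∈ calJ ϖ 𝔫 𝔫) (b ∈ calF ϖ θ (sqfreePart 𝔫)),
          ‖twist ϖ 𝔫 𝔏 ω (χ 𝔏) φ (glPair b (aMat (θ i) * j))‖ₑ)) := by
  refine ⟨exists_eq_zMat_mul_rational_mul_glPair_mul_eta_mul hθ,
    fun ω χ φ _ hφ => iSup_le fun g => ?_⟩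
  obtain ⟨𝔏, h𝔏, i, z, γ, j, hj, b, hb, k, hk, rfl⟩ :=
    exists_eq_zMat_mul_rational_mul_glPair_mul_eta_mul (ϖ := ϖ) (𝔫 := 𝔫) hθ g
  rw [hφ.enorm_apply_eq_enorm_twist ϖ 𝔏 (χ 𝔏) z γ _ hk]
  exact le_iSup₂_of_le 𝔏 h𝔏 (le_iSup_of_le i (le_iSup₂_of_le j hj (le_iSup₂_of_le b hb le_rfl)))
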